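/- Let $d$ be the dimension, and let $\mathcal{P}$ be the set of probability density functions on $\mathbb{R}^d$, i.e. measurable $f:\mathbb{R}^d\to[0,\infty)$ with $\int f\,\mathrm{d}x=1$. Write $\|\cdot\|_p$ for the norm of $\mathcal{L}_p=\mathcal{L}_p(\mathbb{R}^d)$ (Lebesgue measure) and $\|\cdot\|_2$ for the Euclidean norm of a vector. For $\varphi\in\mathcal{P}$ and $\nu>0$ put $\varphi_\nu(x)=\nu^d\varphi(\nu x)$, and let $$\mathcal{P}_\varphi=\{x\mapsto\varphi_\nu(x-\mu) : \mu\in\mathbb{R}^d,\ \nu>0\},$$ $$\mathrm{co}_m(\mathcal{P}_\varphi)=\Big\{\sum_{j=1}^m\pi_j q_j : q_j\in\mathcal{P}_\varphi,\ \pi_j\ge 0,\ \sum_{j=1}^m\pi_j=1\Big\}.$$ For $p\in(1,\infty)$ and $s\in(0,1)$, the space $\mathcal{W}^{s,p}$ consists of the $f\in\mathcal{L}_p$ with $$\|f\|_{s,p}:=\int_{\mathbb{R}^d}\int_{\mathbb{R}^d}\frac{|f(x)-f(y)|^p}{\|x-y\|_2^{d+sp}}\,\mathrm{d}x\,\mathrm{d}y<\infty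 ;$$ $\mathcal{W}^{1,p}$ consists of the $f\in\mathcal{L}_p$ that have all first-order weak partial derivatives in $\mathcal{L}_p$, with weak gradient $\nabla f$. Let $p\in(1,\infty)$, let $q$ be given by $1/p+1/q=1$, and let $s\in(0,1]$. Suppose that $\varphi\in\mathcal{L}_p\cap\mathcal{P}$, $f_0\in\mathcal{W}^{s,p}\cap\mathcal{P}$ and $$\int_{\mathbb{R}^d}\|x\|_2^s\,\varphi(x)\,\mathrm{d}x\le K_1<\infty.$$ Then there exists a sequence $(f_m)_{m\ge1}$ with $f_m\in\mathrm{co}_m(\mathcal{P}_\varphi)$ for each $m\in\mathbb{N}=\{1,2,\dots\}$, such that for all $m\in\mathbb{N}$ $$\|f_m-f_0\|_p\le\begin{cases}K\,m^{-\frac{s}{sq+d}} & \text{if }1<p<2,\\[2pt] K\,m^{-\frac{sq}{2(sq+d)}} & \text{if }2\le p<\infty,\end{cases}$$ where $K<\infty$ is a function of $s,K_1,p,d,\varphi$ and depends on $f_0$ only via $\|f_0\|_{s,p}$ when $s<1$, and only via $\int_{\mathbb{R}^d}\|\nabla f_0(x)\|_2^p\,\mathrm{d}x$ when $s=1$. 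-/

import Mathlib

open MeasureTheory
open scoped ENNReal ContDiff

noncomputable section

namespace MixtureApprox

/-- The space `ℝ^d` with its Euclidean norm; `volume` on it is Lebesgue measure. -/
abbrev Rd (d : ℕ) : Type := EuclideanSpace ℝ (Fin d)

/-- The class `𝒫` of probability density functions on `ℝ^d`. Integrability includes Lebesgue
measurability. -/
structure IsPDF {d : ℕ} (f : Rd d → ℝ) : Prop where
  nonneg : ∀ x, 0 ≤ f x
  integrable : Integrable f volume
  integral_eq_one : ∫ x, f x = 1

/-- The dilation `φ_ν(x) = ν^d φ(ν x)`. -/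
def dilate {d : ℕ} (φ : Rd d → ℝ) (ν : ℝ) : Rd d → ℝ :=
  fun x => ν ^ d * φ (ν • x)

/-- The location-scale class `𝒫_φ = {x ↦ φ_ν(x - μ) | μ ∈ ℝ^d, ν > 0}`. -/
def locScale {d : ℕ} (φ : Rd d → ℝ) : Set (Rd d → ℝ) :=
  {g | ∃ (μ : Rd d) (ν : ℝ), 0 < ν ∧ g = fun x => dilate φ ν (x - μ)}

/-- The `m`-component mixtures `co_m(𝒬)` of a class `𝒬`. -/
def coMix {d : ℕ} (m : ℕ) (Q : Set (Rd d → ℝ)) : Set (Rd d → ℝ) :=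
  {f | ∃ (w : Fin m → ℝ) (g : Fin m → Rd d → ℝ),
    (∀ j, g j ∈ Q) ∧ (∀ j, 0 ≤ w j) ∧ ∑ j, w j = 1 ∧ f = fun x => ∑ j, w j * g j x}

/-- `v` is a weak partial derivative `D_k f` lying in `ℒ_p`. -/
structure IsWeakPartial {d : ℕ} (p : ℝ) (k : Fin d) (f v : Rd d → ℝ) : Prop where
  memLp : MemLp v (ENNReal.ofReal p) volume
  integral_eq : ∀ u : Rd d → ℝ, ContDiff ℝ ∞ u → HasCompactSupport u →
    ∫ x, f x * fderiv ℝ u x (EuclideanSpace.single k 1) = -∫ x, v x * u x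

/-- `f ∈ 𝒲^{1,p}(ℝ^d)`: `f ∈ ℒ_p` and all first-order weak derivatives exist in `ℒ_p`. -/
def MemW1 {d : ℕ} (p : ℝ) (f : Rd d → ℝ) : Prop :=
  MemLp f (ENNReal.ofReal p) volume ∧ ∀ k : Fin d, ∃ v, IsWeakPartial p k f v

open Classical in
/-- The weak partial derivative `D_k f` in `ℒ_p` (zero if there is none); it is unique up to
almost-everywhere equality. -/
def weakPartial {d : ℕ} (p : ℝ) (k : Fin d) (f : Rd d → ℝ) : Rd d → ℝ :=
  if h : ∃ v, IsWeakPartial p k f v then h.choose else 0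

/-- The weak gradient `∇f = (D_1 f, …, D_d f)`. -/
def weakGrad {d : ℕ} (p : ℝ) (f : Rd d → ℝ) : Rd d → Rd d :=
  fun x => WithLp.toLp 2 fun k => weakPartial p k f x

/-- `∫ ‖∇f(x)‖₂^p dx`. -/
def gradEnergy {d : ℕ} (p : ℝ) (f : Rd d → ℝ) : ℝ≥0∞ :=
  ∫⁻ x, ‖weakGrad p f x‖ₑ ^ p

/-- The Gagliardo seminorm (without the `p`-th root)
`‖f‖_{s,p} = ∫ ∫ |f(x) - f(y)|^p / ‖x - y‖₂^(d + s p) dx dy`. -/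
def gagliardo {d : ℕ} (s p : ℝ) (f : Rd d → ℝ) : ℝ≥0∞ :=
  ∫⁻ y, ∫⁻ x, ‖f x - f y‖ₑ ^ p / ‖x - y‖ₑ ^ ((d : ℝ) + s * p)

/-- `f ∈ 𝒲^{s,p}(ℝ^d)` for `0 < s ≤ 1`: fractional (Gagliardo) for `s < 1`, weak derivatives for
`s = 1`. -/
def MemW {d : ℕ} (s p : ℝ) (f : Rd d → ℝ) : Prop :=
  if s < 1 then MemLp f (ENNReal.ofReal p) volume ∧ gagliardo s p f < ⊤ else MemW1 p f

/-- The quantity through which constants may depend on the target `f`: `‖f‖_{s,p}` if `s < 1`, and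
`∫ ‖∇f(x)‖₂^p dx` if `s = 1`. -/
def smoothness {d : ℕ} (s p : ℝ) (f : Rd d → ℝ) : ℝ≥0∞ :=
  if s < 1 then gagliardo s p f else gradEnergy p f

end MixtureApprox

end

open MixtureApprox

open MixtureApprox

/-! The convolution of `f₀` with `φ_ν` is the mean, over `y` distributed with density `f₀`, of the
translates `φ_ν(· - y)`, so it is an infinite mixture from the location-scale class. The error
splits into the bias of this convolution and the error of replacing the mean by an average of `m`
translates.

Bias: since `φ_ν` has mass one, Minkowski's inequality bounds it by the `s`-th moment of `φ_ν`, of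
order `ν^(-s)`, times a Hölder constant of the `ℒ_p` modulus of `f₀`
(`lintegral_smooth_sub_rpow_le`). That constant comes from the Gagliardo seminorm by averaging over
intermediate shifts (`lintegral_sub_rpow_le_gagliardo`), or from the weak gradient by averaging
along a segment (`MemW1.lintegral_sub_rpow_le`).

Sampling: the translates are chosen greedily. Expand `|a + b|^p` to first order at the current error
`a`. The linear term has mean zero over the next translate, so some translate makes it nonpositive,
and the remainder gives a recursion for the `p`-th power of the error (`exists_growth_const`,
`exists_sum_translate_approx`). After division by `m` the error is of order `m^(-τ) ‖φ_ν‖_p`, where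
`τ = 1/q` for `p ≤ 2` and `τ = 1/2` for `p ≥ 2`.

Since `‖φ_ν‖_p = ν^(d/q) ‖φ‖_p`, equating `m^(-τ) ν^(d/q)` with `ν^(-s)` fixes `ν` and gives the
rate. -/

namespace MixtureApprox

/-! ### Scalar inequalities for `|a + b|^p` -/

/-- The signed power `|x|^(p-2) x`, which is `1/p` times the derivative of `|x|^p`. -/
noncomputable def signedPow (p x : ℝ) : ℝ := |x| ^ (p - 2) * x

theorem abs_signedPow {p : ℝ} (hp : 1 < p) (x : ℝ) : |signedPow p x| = |x| ^ (p - 1) := by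
  unfold signedPow
  rcases eq_or_ne x 0 with rfl | hx
  · simp [Real.zero_rpow (by linarith : p - 1 ≠ 0)]
  · rw [abs_mul, abs_of_nonneg (Real.rpow_nonneg (abs_nonneg x) _),
      show p - 1 = (p - 2) + 1 by ring, Real.rpow_add_one (abs_ne_zero.2 hx)]

theorem signedPow_mul_self {p : ℝ} (hp : 1 < p) (x : ℝ) : signedPow p x * x = |x| ^ p := by
  unfold signedPow
  rcases eq_or_ne x 0 with rfl | hx
  · simp [Real.zero_rpow (by linarith : p ≠ 0)]
  · have h : |x| ^ p = |x| ^ (p - 2) * |x| ^ (2 : ℕ) := by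
      rw [← Real.rpow_natCast, ← Real.rpow_add (abs_pos.2 hx)]; norm_num
    rw [h, sq_abs]; ring

theorem signedPow_neg (p x : ℝ) : signedPow p (-x) = -signedPow p x := by
  simp [signedPow]

theorem signedPow_of_nonneg {p x : ℝ} (hp : 1 < p) (hx : 0 ≤ x) :
    signedPow p x = x ^ (p - 1) := by
  have h := abs_signedPow hp x
  have h0 : 0 ≤ signedPow p x := mul_nonneg (Real.rpow_nonneg (abs_nonneg x) _) hx
  rwa [abs_of_nonneg h0, abs_of_nonneg hx] at h

theorem measurable_signedPow (p : ℝ) : Measurable (signedPow p) := by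
  unfold signedPow; fun_prop

/-- Young's inequality for `|a|` and `|c|^(p-1)`, whose conjugate power is `|c|^p`. -/
theorem mul_signedPow_mul_le {p : ℝ} (hp : 1 < p) (a c : ℝ) :
    p * (signedPow p c * a) ≤ |a| ^ p + (p - 1) * |c| ^ p := by
  have hpc := Real.HolderConjugate.conjExponent hp
  have h := Real.young_inequality_of_nonneg (abs_nonneg a)
    (Real.rpow_nonneg (abs_nonneg c) (p - 1)) hpc
  have e : (|c| ^ (p - 1)) ^ (p.conjExponent) = |c| ^ p := by
    rw [← Real.rpow_mul (abs_nonneg c), hpc.sub_one_mul_conj]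
  rw [e] at h
  have h2 : signedPow p c * a ≤ |a| * |c| ^ (p - 1) := by
    rw [← abs_signedPow hp c, mul_comm, ← abs_mul]; exact le_abs_self _
  have h3 : p * (|a| ^ p / p + |c| ^ p / p.conjExponent) = |a| ^ p + (p - 1) * |c| ^ p := by
    unfold Real.conjExponent
    have : p ≠ 0 := by linarith
    have : p - 1 ≠ 0 := by linarith
    field_simp
  rw [← h3]
  exact mul_le_mul_of_nonneg_left (h2.trans h) (by linarith)

/-- Convexity of `|·|^p`, with the tangent taken at `a + b`. Increment bounds for `signedPow` then
move the base point to `a`. -/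
theorem abs_add_rpow_le_add_signedPow {p : ℝ} (hp : 1 < p) (a b : ℝ) :
    |a + b| ^ p ≤ |a| ^ p + p * (signedPow p (a + b) * b) := by
  have h := mul_signedPow_mul_le hp a (a + b)
  have h2 := signedPow_mul_self hp (a + b)
  have : p * (signedPow p (a + b) * a) = p * |a + b| ^ p - p * (signedPow p (a + b) * b) := by
    rw [← h2]; ring
  linarith

/-- To bound the increments of an odd function, it is enough to do so for nonnegative arguments and
for arguments of opposite sign. -/
theorem abs_sub_le_of_odd {J : ℝ → ℝ} (hJ : ∀ x, J (-x) = -J x) {B : ℝ → ℝ → ℝ}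
    (hB : ∀ x y, B x y = B y x) (hBn : ∀ x y, B (-x) (-y) = B x y)
    (h1 : ∀ x y, 0 ≤ y → y ≤ x → |J x - J y| ≤ B x y)
    (h2 : ∀ x y, 0 ≤ x → 0 ≤ y → |J x + J y| ≤ B x (-y)) (x y : ℝ) :
    |J x - J y| ≤ B x y := by
  have h1' : ∀ x y, 0 ≤ x → 0 ≤ y → |J x - J y| ≤ B x y := fun x y hx hy => by
    rcases le_total y x with h | h
    · exact h1 x y hy h
    · rw [abs_sub_comm, hB]; exact h1 y x hx h
  rcases le_total 0 x with hx | hx <;> rcases le_total 0 y with hy | hy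
  · exact h1' x y hx hy
  · have := h2 x (-y) hx (by linarith)
    rwa [hJ, neg_neg, ← sub_eq_add_neg] at this
  · have := h2 y (-x) hy (by linarith)
    rwa [hJ, neg_neg, ← sub_eq_add_neg, abs_sub_comm, hB] at this
  · have := h1' (-x) (-y) (by linarith) (by linarith)
    rwa [hJ, hJ, hBn, neg_sub_neg, abs_sub_comm] at this

/-- For equal signs this is subadditivity of `t^(p-1)`, as `p - 1 ≤ 1`; the factor 2 pays for
opposite signs. -/
theorem abs_signedPow_sub_le_of_le_two {p : ℝ} (hp : 1 < p) (hp2 : p ≤ 2) (x y : ℝ) :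
    |signedPow p x - signedPow p y| ≤ 2 * |x - y| ^ (p - 1) := by
  refine abs_sub_le_of_odd (B := fun x y => 2 * |x - y| ^ (p - 1)) (signedPow_neg p)
    (fun x y => by simp only [abs_sub_comm]) (fun x y => ?_) (fun x y hy hxy => ?_)
    (fun x y hx hy => ?_) x y
  · simp only [neg_sub_neg, abs_sub_comm]
  · have hx := hy.trans hxy
    rw [signedPow_of_nonneg hp hx, signedPow_of_nonneg hp hy, abs_of_nonneg (by linarith : 0 ≤ x - y),
      abs_of_nonneg (sub_nonneg.2 (Real.rpow_le_rpow hy hxy (by linarith)))]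
    have := Real.rpow_add_le_add_rpow (sub_nonneg.2 hxy) hy (by linarith : 0 ≤ p - 1)
      (by linarith)
    rw [sub_add_cancel] at this
    have := Real.rpow_nonneg (sub_nonneg.2 hxy) (p - 1)
    linarith
  · rw [signedPow_of_nonneg hp hx, signedPow_of_nonneg hp hy, sub_neg_eq_add,
      abs_of_nonneg (by positivity), abs_of_nonneg (by positivity)]
    have h1 := Real.rpow_le_rpow hx (by linarith : x ≤ x + y) (by linarith : 0 ≤ p - 1)
    have h2 := Real.rpow_le_rpow hy (by linarith : y ≤ x + y) (by linarith : 0 ≤ p - 1)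
    linarith

/-- Bernoulli's inequality at `y / x`. -/
theorem rpow_sub_rpow_le {α x y : ℝ} (hα : 1 ≤ α) (hy : 0 ≤ y) (hxy : y ≤ x) :
    x ^ α - y ^ α ≤ α * x ^ (α - 1) * (x - y) := by
  rcases (hy.trans hxy).eq_or_lt with rfl | hx
  · have : y = 0 := le_antisymm hxy hy
    simp [this]
  have h := one_add_mul_self_le_rpow_one_add (s := (y - x) / x)
    (by rw [le_div_iff₀ hx]; linarith) hα
  have e : 1 + (y - x) / x = y / x := by field_simp; ring
  rw [e, Real.div_rpow hy hx.le, le_div_iff₀ (by positivity)] at h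
  have e2 : x ^ α = x ^ (α - 1) * x := by
    rw [← Real.rpow_add_one hx.ne']; ring_nf
  have e3 : (1 + α * ((y - x) / x)) * x ^ α = x ^ α + α * x ^ (α - 1) * (y - x) := by
    rw [add_mul, e2]; field_simp
  linarith

theorem abs_signedPow_sub_le_of_two_le {p : ℝ} (hp : 2 ≤ p) (x y : ℝ) :
    |signedPow p x - signedPow p y| ≤ (p - 1) * max |x| |y| ^ (p - 2) * |x - y| := by
  have hp1 : 1 < p := by linarith
  refine abs_sub_le_of_odd (B := fun x y => (p - 1) * max |x| |y| ^ (p - 2) * |x - y|)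
    (signedPow_neg p) (fun x y => by simp only [abs_sub_comm, max_comm]) (fun x y => ?_)
    (fun x y hy hxy => ?_) (fun x y hx hy => ?_) x y
  · simp only [neg_sub_neg, abs_sub_comm, abs_neg]
  · have hx := hy.trans hxy
    rw [signedPow_of_nonneg hp1 hx, signedPow_of_nonneg hp1 hy, abs_of_nonneg hx, abs_of_nonneg hy,
      max_eq_left hxy, abs_of_nonneg (by linarith : 0 ≤ x - y),
      abs_of_nonneg (sub_nonneg.2 (Real.rpow_le_rpow hy hxy (by linarith)))]
    have := rpow_sub_rpow_le (by linarith : 1 ≤ p - 1) hy hxy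
    rwa [show p - 1 - 1 = p - 2 by ring] at this
  · have key : ∀ z, 0 ≤ z → z ≤ max x y → signedPow p z ≤ max x y ^ (p - 2) * z := by
      intro z hz hzm
      unfold signedPow
      rw [abs_of_nonneg hz]
      gcongr
    have h1 := key x hx (le_max_left _ _)
    have h2 := key y hy (le_max_right _ _)
    have hM : 0 ≤ max x y ^ (p - 2) * (x + y) :=
      mul_nonneg (Real.rpow_nonneg (le_max_of_le_left hx) _) (by linarith)
    have n1 : 0 ≤ signedPow p x := mul_nonneg (by positivity) hx
    have n2 : 0 ≤ signedPow p y := mul_nonneg (by positivity) hy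
    simp only [abs_neg, sub_neg_eq_add]
    rw [abs_of_nonneg hx, abs_of_nonneg hy, abs_of_nonneg (add_nonneg hx hy),
      abs_of_nonneg (add_nonneg n1 n2)]
    nlinarith

theorem abs_add_rpow_le_of_le_two {p : ℝ} (hp : 1 < p) (hp2 : p ≤ 2) (a b : ℝ) :
    |a + b| ^ p ≤ |a| ^ p + p * (signedPow p a * b) + 2 * p * |b| ^ p := by
  have h := abs_add_rpow_le_add_signedPow hp a b
  have h2 := abs_signedPow_sub_le_of_le_two hp hp2 (a + b) a
  rw [add_sub_cancel_left] at h2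
  have h3 : (signedPow p (a + b) - signedPow p a) * b ≤ 2 * |b| ^ p := by
    calc _ ≤ |(signedPow p (a + b) - signedPow p a)| * |b| := by
            rw [← abs_mul]; exact le_abs_self _
      _ ≤ 2 * |b| ^ (p - 1) * |b| := by gcongr
      _ = 2 * |b| ^ p := by
        rcases eq_or_ne b 0 with rfl | hb
        · simp [Real.zero_rpow (by linarith : p ≠ 0)]
        · rw [mul_assoc, ← Real.rpow_add_one (abs_ne_zero.2 hb)]; ring_nf
  nlinarith

/-- The natural remainder is `(|a| + |b|)^(p-2) b²`. The parameter `η` trades its mixed part for a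
small multiple of `|a|^p` and a large multiple of `|b|^p`, according to whether `b² ≤ η a²`. -/
theorem abs_add_rpow_le_of_two_le {p : ℝ} (hp : 2 ≤ p) {η : ℝ} (hη : 0 < η) (hη1 : η ≤ 1)
    (a b : ℝ) :
    |a + b| ^ p ≤ |a| ^ p + p * (signedPow p a * b) +
      p * (p - 1) * 2 ^ (p - 2) * (η * |a| ^ p + η ^ (1 - p / 2) * |b| ^ p) := by
  have hp1 : 1 < p := by linarith
  have h := abs_add_rpow_le_add_signedPow hp1 a b
  have h2 := abs_signedPow_sub_le_of_two_le hp (a + b) a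
  rw [add_sub_cancel_left] at h2
  have hmax : max |a + b| |a| ≤ |a| + |b| :=
    max_le (abs_add_le a b) (by linarith [abs_nonneg b])
  have h3 : (signedPow p (a + b) - signedPow p a) * b ≤
      (p - 1) * ((|a| + |b|) ^ (p - 2) * |b| ^ (2 : ℕ)) := by
    calc _ ≤ |(signedPow p (a + b) - signedPow p a)| * |b| := by
            rw [← abs_mul]; exact le_abs_self _
      _ ≤ (p - 1) * max |a + b| |a| ^ (p - 2) * |b| * |b| := by gcongr
      _ ≤ (p - 1) * (|a| + |b|) ^ (p - 2) * |b| * |b| := by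
        gcongr
      _ = _ := by ring
  have sq_split : ∀ z : ℝ, 0 ≤ z → z ^ (p - 2) * z ^ (2 : ℕ) = z ^ p := by
    intro z hz
    rw [← Real.rpow_natCast, ← Real.rpow_add_of_nonneg hz (by linarith) (by norm_num)]
    norm_num
  have h4 : (|a| + |b|) ^ (p - 2) * |b| ^ (2 : ℕ) ≤
      2 ^ (p - 2) * (η * |a| ^ p + η ^ (1 - p / 2) * |b| ^ p) := by
    have A0 := abs_nonneg a
    have B0 := abs_nonneg b
    rcases le_total (|b| ^ 2) (η * |a| ^ 2) with hle | hle
    · have hba : |b| ≤ |a| := by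
        refine (pow_le_pow_iff_left₀ B0 A0 two_ne_zero).1 ?_
        nlinarith [sq_nonneg |a|]
      calc (|a| + |b|) ^ (p - 2) * |b| ^ (2 : ℕ) ≤ (2 * |a|) ^ (p - 2) * (η * |a| ^ 2) := by
            gcongr
            · linarith
        _ = 2 ^ (p - 2) * (η * |a| ^ p) := by
            rw [Real.mul_rpow (by norm_num) A0, ← sq_split _ A0]; ring
        _ ≤ _ := by
            gcongr
            have : 0 ≤ η ^ (1 - p / 2) * |b| ^ p := by positivity
            linarith
    · have hs : 0 < Real.sqrt η := Real.sqrt_pos.2 hη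
      have hab : |a| ≤ |b| / Real.sqrt η := by
        rw [le_div_iff₀ hs]
        refine (pow_le_pow_iff_left₀ (by positivity) B0 two_ne_zero).1 ?_
        rw [mul_pow, Real.sq_sqrt hη.le]; linarith
      have hbb : |b| ≤ |b| / Real.sqrt η := by
        rw [le_div_iff₀ hs]
        have : Real.sqrt η ≤ 1 := Real.sqrt_le_one.2 hη1
        nlinarith
      have e : (Real.sqrt η) ^ (p - 2) * η ^ (1 - p / 2) = 1 := by
        rw [Real.sqrt_eq_rpow, ← Real.rpow_mul hη.le, ← Real.rpow_add hη]
        rw [show 1 / 2 * (p - 2) + (1 - p / 2) = 0 by ring, Real.rpow_zero]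
      have e' : (Real.sqrt η) ^ (p - 2) ≠ 0 := (Real.rpow_pos_of_pos hs _).ne'
      calc (|a| + |b|) ^ (p - 2) * |b| ^ (2 : ℕ)
          ≤ (2 * (|b| / Real.sqrt η)) ^ (p - 2) * |b| ^ 2 := by
            gcongr
            · linarith
        _ = 2 ^ (p - 2) * (η ^ (1 - p / 2) * |b| ^ p) := by
            rw [Real.mul_rpow (by norm_num) (by positivity), Real.div_rpow B0 hs.le,
              eq_inv_of_mul_eq_one_right e, ← sq_split _ B0]
            ring
        _ ≤ _ := by
            gcongr
            have : 0 ≤ η * |a| ^ p := by positivity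
            linarith
  have h5 : p * ((signedPow p (a + b) - signedPow p a) * b) ≤
      p * ((p - 1) * (2 ^ (p - 2) * (η * |a| ^ p + η ^ (1 - p / 2) * |b| ^ p))) := by
    refine mul_le_mul_of_nonneg_left (h3.trans ?_) (by linarith)
    exact mul_le_mul_of_nonneg_left h4 (by linarith)
  nlinarith

/-- The recursion behind the type inequality of `ℒ_p`, with exponent `max 1 (p/2)`. -/
theorem exists_growth_const {p : ℝ} (hp : 1 < p) :
    ∃ A : ℝ, 0 < A ∧ ∀ n : ℕ, ∃ c e : ℝ, 0 ≤ c ∧ 0 ≤ e ∧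
      (∀ a b : ℝ, |a + b| ^ p ≤ c * |a| ^ p + p * (signedPow p a * b) + e * |b| ^ p) ∧
      c * (A * (n : ℝ) ^ max 1 (p / 2)) + e ≤ A * ((n + 1 : ℕ) : ℝ) ^ max 1 (p / 2) := by
  rcases le_total p 2 with hp2 | hp2
  -- For `p ≤ 2` the `p`-th power of the error grows by at most a constant per step, hence linearly.
  · refine ⟨2 * p, by linarith, fun n => ⟨1, 2 * p, by norm_num, by linarith, fun a b => ?_, ?_⟩⟩
    · have := abs_add_rpow_le_of_le_two hp hp2 a b; linarith
    · rw [max_eq_left (by linarith), Real.rpow_one, Real.rpow_one]; push_cast; linarith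
  · rw [max_eq_right (by linarith)]
    set Λ : ℝ := p * (p - 1) * 2 ^ (p - 2) with hΛ
    have h2p : (1 : ℝ) ≤ 2 ^ (p - 2) := Real.one_le_rpow (by norm_num) (by linarith)
    have hΛp : p ≤ Λ := by
      rw [hΛ]; nlinarith [mul_le_mul_of_nonneg_left h2p (by nlinarith : 0 ≤ p * (p - 1))]
    have hΛ0 : 0 < Λ := by linarith
    -- Bernoulli gives `(n+1)^(p/2)` a surplus of `(p/2) n^(p/2-1)`. With `η = θ/n`, the choice of
    -- `θ` makes the growth of `c` use half of it, and the choice of `A` leaves the other half for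
    -- `e`.
    set θ : ℝ := p / (4 * Λ) with hθ
    have hθ0 : 0 < θ := by positivity
    have hθ1 : θ ≤ 1 := by rw [hθ, div_le_one (by linarith)]; linarith
    have hLθ : Λ * θ = p / 4 := by rw [hθ]; field_simp
    set A : ℝ := max Λ (4 / p * (Λ * θ ^ (1 - p / 2))) with hA
    have hAΛ : Λ ≤ A := le_max_left _ _
    have hA2 : Λ * θ ^ (1 - p / 2) ≤ p / 4 * A := by
      have : 4 / p * (Λ * θ ^ (1 - p / 2)) ≤ A := le_max_right _ _
      rw [div_mul_eq_mul_div, div_le_iff₀ (by linarith)] at this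
      linarith
    have hA0 : 0 < A := by linarith
    refine ⟨A, hA0, fun n => ?_⟩
    rcases Nat.eq_zero_or_pos n with rfl | hn
    -- At `n = 0` the accumulated error vanishes, so the size of `c` is irrelevant and `η = 1`
    -- serves.
    · refine ⟨1 + Λ, Λ, by linarith, hΛ0.le, fun a b => ?_, ?_⟩
      · have := abs_add_rpow_le_of_two_le hp2 one_pos le_rfl a b
        rw [Real.one_rpow, ← hΛ] at this
        linarith
      · simp [Real.zero_rpow (by linarith : p / 2 ≠ 0)]
        exact hAΛ
    · have hn0 : (0 : ℝ) < n := by exact_mod_cast hn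
      have hn1 : (1 : ℝ) ≤ n := by exact_mod_cast hn
      have hη0 : 0 < θ / n := by positivity
      have hη1 : θ / n ≤ 1 := by rw [div_le_one hn0]; linarith
      refine ⟨1 + Λ * (θ / n), Λ * (θ / n) ^ (1 - p / 2), by positivity, by positivity,
        fun a b => ?_, ?_⟩
      · have := abs_add_rpow_le_of_two_le hp2 hη0 hη1 a b
        rw [← hΛ] at this
        linarith
      · have e1 : (n : ℝ) ^ (p / 2) = (n : ℝ) ^ (p / 2 - 1) * n := by
          rw [← Real.rpow_add_one hn0.ne']; ring_nf
        have e2 : (θ / n) ^ (1 - p / 2) = θ ^ (1 - p / 2) * (n : ℝ) ^ (p / 2 - 1) := by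
          rw [Real.div_rpow hθ0.le hn0.le, div_eq_mul_inv, ← Real.rpow_neg hn0.le, neg_sub]
        set N := (n : ℝ) ^ (p / 2 - 1) with hN
        have hN0 : 0 < N := Real.rpow_pos_of_pos hn0 _
        have hb : N * n + p / 2 * N ≤ ((n : ℝ) + 1) ^ (p / 2) := by
          have := one_add_mul_self_le_rpow_one_add (s := 1 / n) (p := p / 2)
            (by have : (0:ℝ) ≤ 1 / n := by positivity
                linarith) (by linarith)
          have e : ((n : ℝ) + 1) ^ (p / 2) = (1 + 1 / n) ^ (p / 2) * (n : ℝ) ^ (p / 2) := by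
            rw [← Real.mul_rpow (by positivity) hn0.le]; congr 1; field_simp
          rw [e]
          calc N * n + p / 2 * N = (1 + p / 2 * (1 / n)) * (n : ℝ) ^ (p / 2) := by
                rw [e1]; field_simp
            _ ≤ _ := by gcongr
        push_cast
        rw [e1, e2]
        have k1 : (1 + Λ * (θ / n)) * (A * (N * n)) = A * (N * n) + Λ * θ * A * N := by
          field_simp
        rw [k1, hLθ]
        have k2 : Λ * (θ ^ (1 - p / 2) * N) ≤ p / 4 * A * N := by
          rw [← mul_assoc]; exact mul_le_mul_of_nonneg_right hA2 hN0.le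
        have k3 := mul_le_mul_of_nonneg_left hb hA0.le
        nlinarith

/-- Young's inequality for `a` and `-a`; the domination behind the integrability of the linear term.
-/
theorem abs_signedPow_mul_le {p : ℝ} (hp : 1 < p) (c a : ℝ) :
    |signedPow p c * a| ≤ |c| ^ p + |a| ^ p := by
  have h1 := mul_signedPow_mul_le hp a c
  have h2 := mul_signedPow_mul_le hp (-a) c
  rw [abs_neg] at h2
  have c0 : 0 ≤ |c| ^ p := by positivity
  have a0 : 0 ≤ |a| ^ p := by positivity
  have key : |a| ^ p + (p - 1) * |c| ^ p ≤ p * (|c| ^ p + |a| ^ p) := by nlinarith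
  rw [abs_le]
  constructor
  · have : p * (signedPow p c * -a) ≤ p * (|c| ^ p + |a| ^ p) := h2.trans key
    have := le_of_mul_le_mul_left this (by linarith)
    linarith
  · exact le_of_mul_le_mul_left (h1.trans key) (by linarith)

/-! ### Hölder's inequality and `p`-th powers in `ℒ_p` -/

theorem lintegral_rpow_le {α : Type*} [MeasurableSpace α] {μ : Measure α} {p : ℝ} (hp : 1 < p)
    {k : α → ℝ≥0∞} (hk : AEMeasurable k μ) :
    (∫⁻ a, k a ∂μ) ^ p ≤ μ Set.univ ^ (p - 1) * ∫⁻ a, k a ^ p ∂μ := by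
  have hpq := Real.HolderConjugate.conjExponent hp
  have h := ENNReal.lintegral_mul_le_Lp_mul_Lq μ hpq hk (aemeasurable_const (b := (1 : ℝ≥0∞)))
  simp only [Pi.mul_apply, mul_one, ENNReal.one_rpow, lintegral_one] at h
  calc (∫⁻ a, k a ∂μ) ^ p
      ≤ ((∫⁻ a, k a ^ p ∂μ) ^ (1 / p) * μ Set.univ ^ (1 / p.conjExponent)) ^ p :=
        ENNReal.rpow_le_rpow h (by linarith)
    _ = μ Set.univ ^ (p - 1) * ∫⁻ a, k a ^ p ∂μ := by
        rw [ENNReal.mul_rpow_of_nonneg _ _ (by linarith : 0 ≤ p), ← ENNReal.rpow_mul,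
          ← ENNReal.rpow_mul, one_div_mul_cancel (by linarith : p ≠ 0), ENNReal.rpow_one, mul_comm,
          one_div, ← hpq.one_sub_inv]
        congr 2
        field_simp

section Lp

variable {α : Type*} [MeasurableSpace α] {μ : Measure α} {p : ℝ} {f g : α → ℝ}

theorem eLpNorm_ofReal_rpow (hp : 1 < p) :
    eLpNorm f (ENNReal.ofReal p) μ ^ p = ∫⁻ x, ‖f x‖ₑ ^ p ∂μ := by
  rw [eLpNorm_eq_lintegral_rpow_enorm_toReal (by simp; linarith) ENNReal.ofReal_ne_top,
    ENNReal.toReal_ofReal (by linarith), ← ENNReal.rpow_mul, one_div_mul_cancel (by linarith),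
    ENNReal.rpow_one]

theorem _root_.MeasureTheory.MemLp.integrable_abs_rpow (hp : 1 < p) (hf : MemLp f (ENNReal.ofReal p) μ) :
    Integrable (fun x => |f x| ^ p) μ := by
  have := hf.integrable_norm_rpow (by simp; linarith) ENNReal.ofReal_ne_top
  rwa [ENNReal.toReal_ofReal (by linarith)] at this

theorem _root_.MeasureTheory.MemLp.integral_abs_rpow (hp : 1 < p) (hf : MemLp f (ENNReal.ofReal p) μ) :
    ∫ x, |f x| ^ p ∂μ = (eLpNorm f (ENNReal.ofReal p) μ).toReal ^ p := by
  have hpos : 0 ≤ ∫ x, |f x| ^ p ∂μ := integral_nonneg fun x => by positivity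
  rw [hf.eLpNorm_eq_integral_rpow_norm (by simp; linarith) ENNReal.ofReal_ne_top,
    ENNReal.toReal_ofReal (by positivity), ENNReal.toReal_ofReal (by linarith),
    ← Real.rpow_mul (integral_nonneg fun x => by positivity), inv_mul_cancel₀ (by linarith),
    Real.rpow_one]
  rfl

theorem _root_.MeasureTheory.MemLp.integrable_signedPow_mul (hp : 1 < p) (hf : MemLp f (ENNReal.ofReal p) μ)
    (hg : MemLp g (ENNReal.ofReal p) μ) : Integrable (fun x => signedPow p (f x) * g x) μ := by
  refine Integrable.mono' (hf.integrable_abs_rpow hp |>.add (hg.integrable_abs_rpow hp)) ?_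
    (Filter.Eventually.of_forall fun x => abs_signedPow_mul_le hp _ _)
  exact ((measurable_signedPow p).comp_aemeasurable hf.1.aemeasurable).aestronglyMeasurable.mul hg.1

end Lp

/-! ### Means of translates and greedy sampling -/

section Translate

variable {E : Type*} [NormedAddCommGroup E] [MeasurableSpace E] [BorelSpace E]
  {vol : Measure E} [vol.IsAddRightInvariant] {p : ℝ} {ψ : E → ℝ}

theorem _root_.MeasureTheory.MemLp.translate (hψ : MemLp ψ (ENNReal.ofReal p) vol) (y : E) :
    MemLp (fun x => ψ (x - y)) (ENNReal.ofReal p) vol :=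
  hψ.comp_measurePreserving (measurePreserving_sub_right vol y)

theorem eLpNorm_translate (hψ : Measurable ψ) (y : E) :
    eLpNorm (fun x => ψ (x - y)) (ENNReal.ofReal p) vol = eLpNorm ψ (ENNReal.ofReal p) vol :=
  eLpNorm_comp_measurePreserving hψ.aestronglyMeasurable (measurePreserving_sub_right vol y)

variable [SecondCountableTopology E] [SFinite vol] {μ : Measure E} [IsProbabilityMeasure μ]

theorem measurable_smooth (hψ : Measurable ψ) : Measurable fun x => ∫ y, ψ (x - y) ∂μ :=
  (StronglyMeasurable.integral_prod_right (f := fun x y => ψ (x - y))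
    (hψ.comp (measurable_fst.sub measurable_snd)).stronglyMeasurable).measurable

/-- Jensen in `y`, then Tonelli and translation invariance. -/
theorem eLpNorm_smooth_le (hp : 1 < p) (hψ : Measurable ψ) :
    eLpNorm (fun x => ∫ y, ψ (x - y) ∂μ) (ENNReal.ofReal p) vol ≤
      eLpNorm ψ (ENNReal.ofReal p) vol := by
  rw [← ENNReal.rpow_le_rpow_iff (show 0 < p by linarith), eLpNorm_ofReal_rpow hp,
    eLpNorm_ofReal_rpow hp]
  calc ∫⁻ x, ‖∫ y, ψ (x - y) ∂μ‖ₑ ^ p ∂vol ≤ ∫⁻ x, ∫⁻ y, ‖ψ (x - y)‖ₑ ^ p ∂μ ∂vol := by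
        refine lintegral_mono fun x => ?_
        refine (ENNReal.rpow_le_rpow (enorm_integral_le_lintegral_enorm _) (by linarith)).trans ?_
        refine (lintegral_rpow_le hp ?_).trans (by simp)
        exact (hψ.comp (measurable_const.sub measurable_id)).enorm.aemeasurable
    _ = ∫⁻ y, ∫⁻ x, ‖ψ (x - y)‖ₑ ^ p ∂vol ∂μ := by
        refine lintegral_lintegral_swap ?_
        exact ((hψ.comp (measurable_fst.sub measurable_snd)).enorm.pow_const p).aemeasurable
    _ = ∫⁻ y, ∫⁻ x, ‖ψ x‖ₑ ^ p ∂vol ∂μ := by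
        congr 1 with y
        exact lintegral_sub_right_eq_self (fun x => ‖ψ x‖ₑ ^ p) y
    _ = _ := by simp

theorem integrable_prod_translate {k : E → ℝ} (hk : Measurable k) (hki : Integrable k vol) :
    Integrable (fun z : E × E => k (z.1 - z.2)) (vol.prod μ) := by
  refine (integrable_prod_iff' (f := fun z : E × E => k (z.1 - z.2))
    (hk.comp (measurable_fst.sub measurable_snd)).aestronglyMeasurable).2 ⟨Filter.Eventually.of_forall fun y => hki.comp_sub_right y, ?_⟩
  have : (fun y => ∫ x, ‖k (x - y)‖ ∂vol) = fun _ : E => ∫ x, ‖k x‖ ∂vol := by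
    ext y
    exact integral_sub_right_eq_self (fun x => ‖k x‖) y
  rw [this]
  exact integrable_const _

/-- A linear functional is at most its mean at some translate. -/
theorem exists_translate_integral_nonpos (hp : 1 < p) (hψ : Measurable ψ)
    (hψp : MemLp ψ (ENNReal.ofReal p) vol) {a : E → ℝ} (ha : Measurable a)
    (hap : MemLp a (ENNReal.ofReal p) vol) :
    ∃ y, ∫ x, signedPow p (a x) * (ψ (x - y) - ∫ t, ψ (x - t) ∂μ) ∂vol ≤ 0 := by
  have hgp : MemLp (fun x => ∫ t, ψ (x - t) ∂μ) (ENNReal.ofReal p) vol :=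
    ⟨(measurable_smooth hψ).aestronglyMeasurable, (eLpNorm_smooth_le hp hψ).trans_lt hψp.2⟩
  have hprod : Integrable (fun z : E × E => signedPow p (a z.1) * ψ (z.1 - z.2))
      (vol.prod μ) := by
    have h1 := (hap.integrable_abs_rpow hp).comp_fst μ
    have h2 := integrable_prod_translate (μ := μ) (hψ.abs.pow_const p)
      (hψp.integrable_abs_rpow hp)
    refine Integrable.mono' (h1.add h2) ?_
      (Filter.Eventually.of_forall fun z => abs_signedPow_mul_le hp _ _)
    exact (((measurable_signedPow p).comp (ha.comp measurable_fst)).mul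
      (hψ.comp (measurable_fst.sub measurable_snd))).aestronglyMeasurable
  -- Some `y` gives a value at most the mean; by Fubini the mean is the pairing with the averaged
  -- function.
  obtain ⟨y, hy⟩ := exists_le_integral (μ := μ) hprod.integral_prod_right
  refine ⟨y, ?_⟩
  rw [← integral_integral_swap hprod] at hy
  simp_rw [mul_sub]
  rw [integral_sub (hap.integrable_signedPow_mul hp (hψp.translate y))
    (hap.integrable_signedPow_mul hp hgp)]
  simp_rw [integral_const_mul] at hy
  linarith

theorem eLpNorm_translate_sub_smooth_le (hp : 1 < p) (hψ : Measurable ψ) (y : E) :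
    eLpNorm (fun x => ψ (x - y) - ∫ t, ψ (x - t) ∂μ) (ENNReal.ofReal p) vol ≤
      2 * eLpNorm ψ (ENNReal.ofReal p) vol := by
  refine (eLpNorm_sub_le (f := fun x => ψ (x - y)) (g := fun x => ∫ t, ψ (x - t) ∂μ)
    (hψ.comp (measurable_id.sub_const y)).aestronglyMeasurable
    (measurable_smooth hψ).aestronglyMeasurable (by simpa using hp.le)).trans ?_
  rw [eLpNorm_translate hψ, two_mul]
  gcongr
  exact eLpNorm_smooth_le hp hψ

/-- Averages of translates of `ψ` approximate the `μ`-mean of its translates. -/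
theorem exists_sum_translate_approx (hp : 1 < p) :
    ∃ A : ℝ, 0 < A ∧ ∀ (μ : Measure E) [IsProbabilityMeasure μ] (ψ : E → ℝ), Measurable ψ →
      MemLp ψ (ENNReal.ofReal p) vol → ∀ n : ℕ, ∃ y : Fin n → E,
        ∫ x, |∑ i, (ψ (x - y i) - ∫ t, ψ (x - t) ∂μ)| ^ p ∂vol ≤
          A * (n : ℝ) ^ max 1 (p / 2) * (2 * (eLpNorm ψ (ENNReal.ofReal p) vol).toReal) ^ p := by
  obtain ⟨A, hA, hstep⟩ := exists_growth_const hp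
  refine ⟨A, hA, fun μ _ ψ hψ hψp n => ?_⟩
  set g : E → ℝ := fun x => ∫ t, ψ (x - t) ∂μ with hg
  have hgm : Measurable g := measurable_smooth hψ
  have hX : ∀ y, MemLp (fun x => ψ (x - y) - g x) (ENNReal.ofReal p) vol := fun y =>
    (hψp.translate y).sub ⟨hgm.aestronglyMeasurable, (eLpNorm_smooth_le hp hψ).trans_lt hψp.2⟩
  set σ : ℝ := (2 * (eLpNorm ψ (ENNReal.ofReal p) vol).toReal) ^ p with hσ
  have hXσ : ∀ y, ∫ x, |ψ (x - y) - g x| ^ p ∂vol ≤ σ := fun y => by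
    rw [(hX y).integral_abs_rpow hp]
    refine Real.rpow_le_rpow ENNReal.toReal_nonneg ?_ (by linarith)
    have h := ENNReal.toReal_mono (ENNReal.mul_ne_top (by simp) hψp.2.ne)
      (eLpNorm_translate_sub_smooth_le (vol := vol) (μ := μ) hp hψ y)
    simpa using h
  change ∃ y : Fin n → E, ∫ x, |∑ i, (ψ (x - y i) - g x)| ^ p ∂vol ≤ _
  induction n with
  | zero => exact ⟨Fin.elim0, by simp [Real.zero_rpow (by linarith : p ≠ 0),
      Real.zero_rpow (lt_max_of_lt_left one_pos : 0 < max 1 (p / 2)).ne']⟩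
  | succ n ih =>
    obtain ⟨y, hy⟩ := ih
    set a : E → ℝ := fun x => ∑ i, (ψ (x - y i) - g x) with ha
    have ham : Measurable a := Finset.measurable_sum _ fun i _ =>
      (hψ.comp (measurable_id.sub_const _)).sub hgm
    have hap : MemLp a (ENNReal.ofReal p) vol := memLp_finsetSum _ fun i _ => hX (y i)
    -- The greedy choice: `z` makes the first-order term of the expansion at `a` nonpositive.
    obtain ⟨z, hz⟩ := exists_translate_integral_nonpos (μ := μ) hp hψ hψp ham hap
    obtain ⟨c, e, hc, he, hpt, hrec⟩ := hstep n
    refine ⟨Fin.snoc y z, ?_⟩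
    have hsum : ∀ x, ∑ i, (ψ (x - (Fin.snoc y z : Fin (n + 1) → E) i) - g x) =
        a x + (ψ (x - z) - g x) := fun x => by
      rw [Fin.sum_univ_castSucc]; simp [ha]
    simp_rw [hsum]
    have i1 := hap.integrable_abs_rpow hp
    have i2 := hap.integrable_signedPow_mul hp (hX z)
    have i3 := (hX z).integrable_abs_rpow hp
    calc ∫ x, |a x + (ψ (x - z) - g x)| ^ p ∂vol
        ≤ ∫ x, (c * |a x| ^ p + p * (signedPow p (a x) * (ψ (x - z) - g x)) +
            e * |ψ (x - z) - g x| ^ p) ∂vol := by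
          refine integral_mono ((hap.add (hX z)).integrable_abs_rpow hp)
            (((i1.const_mul c).add (i2.const_mul p)).add (i3.const_mul e)) fun x => hpt _ _
      _ = c * ∫ x, |a x| ^ p ∂vol + p * ∫ x, signedPow p (a x) * (ψ (x - z) - g x) ∂vol +
            e * ∫ x, |ψ (x - z) - g x| ^ p ∂vol := by
          have i12 : Integrable (fun x => c * |a x| ^ p +
              p * (signedPow p (a x) * (ψ (x - z) - g x))) vol :=
            (i1.const_mul c).add (i2.const_mul p)
          rw [integral_add i12 (i3.const_mul e),
            integral_add (i1.const_mul c) (i2.const_mul p), integral_const_mul,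
            integral_const_mul, integral_const_mul]
      _ ≤ c * (A * (n : ℝ) ^ max 1 (p / 2) * σ) + p * 0 + e * σ := by
          gcongr
          exact hXσ z
      _ = (c * (A * (n : ℝ) ^ max 1 (p / 2)) + e) * σ := by ring
      _ ≤ _ := by gcongr

end Translate

/-! ### Bias of the convolution -/

section Bias

variable {d : ℕ} {p s : ℝ} {ψ f : Rd d → ℝ} {B : ℝ≥0∞}

/-- Minkowski's inequality for a mean of differences whose `ℒ_p` norms are Hölder in the shift. -/
theorem lintegral_integral_mul_sub_rpow_le (hp : 1 < p) (hs : 0 < s) (hψ : Measurable ψ)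
    (hf : Measurable f)
    (hB : ∀ y, ∫⁻ x, ‖f (x - y) - f x‖ₑ ^ p ≤ B * ‖y‖ₑ ^ (s * p)) :
    ∫⁻ x, ‖∫ y, ψ y * (f (x - y) - f x)‖ₑ ^ p ≤ B * (∫⁻ y, ‖ψ y‖ₑ * ‖y‖ₑ ^ s) ^ p := by
  -- Jensen is applied to the measure with density `w`, so the integrand becomes the difference
  -- quotient with `‖y‖^s`, whose `p`-th power has `x`-integral at most `B` for every `y`.
  set w : Rd d → ℝ≥0∞ := fun y => ‖ψ y‖ₑ * ‖y‖ₑ ^ s with hw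
  have hwm : Measurable w := by fun_prop
  set μ : Measure (Rd d) := volume.withDensity w with hμ
  have hμu : μ Set.univ = ∫⁻ y, w y := by simp [hμ]
  have hkm : Measurable fun z : Rd d × Rd d => ‖f (z.1 - z.2) - f z.1‖ₑ / ‖z.2‖ₑ ^ s := by
    fun_prop
  have hkx : ∀ x, Measurable fun y => ‖f (x - y) - f x‖ₑ / ‖y‖ₑ ^ s := fun x => by fun_prop
  have hp0 : 0 ≤ p := by linarith
  calc ∫⁻ x, ‖∫ y, ψ y * (f (x - y) - f x)‖ₑ ^ p
      ≤ ∫⁻ x, (∫⁻ y, ‖f (x - y) - f x‖ₑ / ‖y‖ₑ ^ s ∂μ) ^ p := by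
        refine lintegral_mono fun x => ENNReal.rpow_le_rpow ?_ hp0
        refine (enorm_integral_le_lintegral_enorm _).trans (le_of_eq ?_)
        rw [hμ, lintegral_withDensity_eq_lintegral_mul _ hwm (hkx x)]
        congr 1 with y
        simp only [enorm_mul, Pi.mul_apply, hw]
        rcases eq_or_ne y 0 with rfl | hy
        · simp
        · rw [mul_assoc, ENNReal.mul_div_cancel]
          · simp [hy]
          · exact ENNReal.rpow_ne_top_of_nonneg hs.le (by simp)
    _ ≤ ∫⁻ x, (∫⁻ y, w y) ^ (p - 1) * ∫⁻ y, (‖f (x - y) - f x‖ₑ / ‖y‖ₑ ^ s) ^ p ∂μ := by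
        refine lintegral_mono fun x => ?_
        rw [← hμu]
        exact lintegral_rpow_le hp (hkx x).aemeasurable
    _ = (∫⁻ y, w y) ^ (p - 1) * ∫⁻ y, (∫⁻ x, (‖f (x - y) - f x‖ₑ / ‖y‖ₑ ^ s) ^ p) ∂μ := by
        have : SFinite μ := by rw [hμ]; infer_instance
        rw [lintegral_const_mul, lintegral_lintegral_swap]
        · exact (hkm.pow_const p).aemeasurable
        · exact (hkm.pow_const p).lintegral_prod_right
    _ ≤ (∫⁻ y, w y) ^ (p - 1) * ∫⁻ _, B ∂μ := by
        gcongr with y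
        simp_rw [ENNReal.div_rpow_of_nonneg _ _ hp0, ← ENNReal.rpow_mul, div_eq_mul_inv]
        rw [lintegral_mul_const _ (by fun_prop), ← div_eq_mul_inv]
        exact ENNReal.div_le_of_le_mul (hB y)
    _ = _ := by
        rw [lintegral_const, hμu, mul_left_comm]
        congr 1
        nth_rw 2 [← ENNReal.rpow_one (∫⁻ y, w y)]
        rw [← ENNReal.rpow_add_of_nonneg _ _ (by linarith) one_pos.le, sub_add_cancel]

/-- The substitution `y ↦ x - y` moves the shift onto `f`, and the unit mass of `ψ` absorbs `f x`.
Only almost every `x` is covered, as the convolution of two integrable functions need not exist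
everywhere. -/
theorem integral_withDensity_sub_eq (hf : Measurable f) (hf0 : ∀ x, 0 ≤ f x)
    (hfi : Integrable f) (hψi : Integrable ψ) (hψ1 : ∫ x, ψ x = 1) :
    ∀ᵐ x, (∫ y, ψ (x - y) ∂(volume.withDensity fun y => ENNReal.ofReal (f y))) - f x =
      ∫ y, ψ y * (f (x - y) - f x) := by
  have h := hψi.ae_convolution_exists (ContinuousLinearMap.mul ℝ ℝ) hfi
  filter_upwards [h] with x hx
  have hx' : Integrable fun y => ψ y * f (x - y) := hx
  rw [integral_withDensity_eq_integral_toReal_smul (by fun_prop) (by simp)]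
  have e1 : ∫ y, (ENNReal.ofReal (f y)).toReal • ψ (x - y) = ∫ y, ψ y * f (x - y) := by
    rw [← integral_sub_left_eq_self _ volume x]
    congr 1 with y
    rw [ENNReal.toReal_ofReal (hf0 _), sub_sub_cancel, smul_eq_mul, mul_comm]
  rw [e1]
  simp_rw [mul_sub]
  rw [integral_sub hx' (hψi.mul_const _), integral_mul_const, hψ1, one_mul]

/-- The error of approximating `f` by its convolution with `ψ`. -/
theorem lintegral_smooth_sub_rpow_le (hp : 1 < p) (hs : 0 < s) (hψ : Measurable ψ)
    (hψi : Integrable ψ) (hψ1 : ∫ x, ψ x = 1) (hf : Measurable f) (hf0 : ∀ x, 0 ≤ f x)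
    (hfi : Integrable f)
    (hB : ∀ y, ∫⁻ x, ‖f (x - y) - f x‖ₑ ^ p ≤ B * ‖y‖ₑ ^ (s * p)) :
    ∫⁻ x, ‖(∫ y, ψ (x - y) ∂(volume.withDensity fun y => ENNReal.ofReal (f y))) - f x‖ₑ ^ p ≤
      B * (∫⁻ y, ‖ψ y‖ₑ * ‖y‖ₑ ^ s) ^ p := by
  refine le_trans (le_of_eq (lintegral_congr_ae ?_))
    (lintegral_integral_mul_sub_rpow_le hp hs hψ hf hB)
  filter_upwards [integral_withDensity_sub_eq hf hf0 hfi hψi hψ1] with x hx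
  rw [hx]

end Bias

/-! ### Modulus of continuity from the Gagliardo seminorm -/

section Fractional

variable {d : ℕ} {p s : ℝ} {f : Rd d → ℝ}

theorem gagliardo_congr {g : Rd d → ℝ} (h : f =ᵐ[volume] g) : gagliardo s p f = gagliardo s p g := by
  refine lintegral_congr_ae ?_
  filter_upwards [h] with y hy
  refine lintegral_congr_ae ?_
  filter_upwards [h] with x hx
  rw [hx, hy]

theorem gagliardo_eq (hf : Measurable f) :
    gagliardo s p f = ∫⁻ z, (∫⁻ x, ‖f (x - z) - f x‖ₑ ^ p) / ‖z‖ₑ ^ ((d : ℝ) + s * p) := by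
  unfold gagliardo
  have h : ∀ y, ∫⁻ x, ‖f x - f y‖ₑ ^ p / ‖x - y‖ₑ ^ ((d : ℝ) + s * p) =
      ∫⁻ z, ‖f (y - z) - f y‖ₑ ^ p / ‖z‖ₑ ^ ((d : ℝ) + s * p) := fun y => by
    rw [← lintegral_sub_left_eq_self _ y]
    congr 1 with z
    rw [sub_sub_cancel_left, enorm_neg]
  simp_rw [h]
  rw [lintegral_lintegral_swap (by fun_prop)]
  congr 1 with z
  simp_rw [div_eq_mul_inv]
  rw [lintegral_mul_const _ (by fun_prop)]

/-- The shift by `y` is the shift by `z` followed by the shift by `y - z`. -/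
theorem lintegral_sub_rpow_triangle (hp : 1 ≤ p) (hf : Measurable f) (y z : Rd d) :
    ∫⁻ x, ‖f (x - y) - f x‖ₑ ^ p ≤ 2 ^ (p - 1) *
      ((∫⁻ x, ‖f (x - z) - f x‖ₑ ^ p) + ∫⁻ x, ‖f (x - (y - z)) - f x‖ₑ ^ p) := by
  have h : ∫⁻ x, ‖f (x - (y - z)) - f x‖ₑ ^ p = ∫⁻ x, ‖f (x - y) - f (x - z)‖ₑ ^ p := by
    rw [← lintegral_sub_right_eq_self _ z]
    congr 1 with x
    rw [sub_sub, add_sub_cancel]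
  rw [h, ← lintegral_add_left (by fun_prop), ← lintegral_const_mul _ (by fun_prop)]
  refine lintegral_mono fun x => ?_
  refine le_trans (ENNReal.rpow_le_rpow ?_ (by linarith))
    (ENNReal.rpow_add_le_mul_rpow_add_rpow _ _ hp)
  calc ‖f (x - y) - f x‖ₑ = ‖(f (x - z) - f x) + (f (x - y) - f (x - z))‖ₑ := by congr 1; ring
    _ ≤ _ := enorm_add_le _ _

/-- A Gagliardo bound controls the `ℒ_p` modulus of continuity. -/
theorem lintegral_sub_rpow_le_gagliardo (hp : 1 < p) (hs : 0 < s) (hf : Measurable f) (y : Rd d) :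
    ∫⁻ x, ‖f (x - y) - f x‖ₑ ^ p ≤
      2 ^ p * 2 ^ ((d : ℝ) + s * p) / volume (Metric.ball (0 : Rd d) 1) * gagliardo s p f *
        ‖y‖ₑ ^ (s * p) := by
  rcases eq_or_ne y 0 with rfl | hy
  · simp [ENNReal.zero_rpow_of_pos (by linarith : 0 < p)]
  set W : Rd d → ℝ≥0∞ := fun z => ∫⁻ x, ‖f (x - z) - f x‖ₑ ^ p with hW
  have hWm : Measurable W :=
    (show Measurable fun z : Rd d × Rd d => ‖f (z.2 - z.1) - f z.2‖ₑ ^ p by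
      fun_prop).lintegral_prod_right
  set c := volume (Metric.ball (0 : Rd d) 1) with hc
  have hc0 : c ≠ 0 := (Metric.measure_ball_pos volume _ one_pos).ne'
  have hct : c ≠ ⊤ := measure_ball_lt_top.ne
  set e : ℝ := (d : ℝ) + s * p with he
  have he0 : 0 < e := by positivity
  have hr : 0 < ‖y‖ := norm_pos_iff.2 hy
  -- For `‖z‖ < ‖y‖` both `z` and `y - z` lie in the ball of radius `2‖y‖`, where the Gagliardo
  -- weight is at least `(2‖y‖)^(-e)`. Averaging the triangle inequality over such `z` therefore
  -- bounds `W y`.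
  set H : Rd d → ℝ≥0∞ := (Metric.ball (0 : Rd d) (2 * ‖y‖)).indicator W with hH
  have hHm : Measurable H := hWm.indicator measurableSet_ball
  have hHint : ∫⁻ z, H z ≤ (2 * ‖y‖ₑ) ^ e * gagliardo s p f := by
    rw [gagliardo_eq hf, ← lintegral_const_mul _ (by fun_prop)]
    refine lintegral_mono fun z => ?_
    by_cases hz : z ∈ Metric.ball (0 : Rd d) (2 * ‖y‖)
    · rw [hH, Set.indicator_of_mem hz]
      rcases eq_or_ne z 0 with rfl | hz0
      · simp [hW, ENNReal.zero_rpow_of_pos (by linarith : 0 < p)]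
      · have hze : ‖z‖ₑ ^ e ≠ 0 := by simp [hz0]
        have hzt : ‖z‖ₑ ^ e ≠ ⊤ := ENNReal.rpow_ne_top_of_nonneg he0.le (by simp)
        calc W z = ‖z‖ₑ ^ e * (W z / ‖z‖ₑ ^ e) := (ENNReal.mul_div_cancel hze hzt).symm
          _ ≤ _ := by
            gcongr
            rw [mem_ball_zero_iff] at hz
            have h2 : ENNReal.ofReal (2 * ‖y‖) = 2 * ‖y‖ₑ := by
              rw [ENNReal.ofReal_mul (by norm_num), ofReal_norm, ENNReal.ofReal_ofNat]
            rw [← h2, ← ofReal_norm]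
            exact ENNReal.ofReal_le_ofReal hz.le
    · rw [hH, Set.indicator_of_notMem hz]
      exact zero_le
  have h1 : W y * volume (Metric.ball (0 : Rd d) ‖y‖) ≤ 2 ^ p * ((2 * ‖y‖ₑ) ^ e * gagliardo s p f) := by
    calc W y * volume (Metric.ball (0 : Rd d) ‖y‖) = ∫⁻ _ in Metric.ball (0 : Rd d) ‖y‖, W y := by
          rw [setLIntegral_const]
      _ ≤ ∫⁻ z in Metric.ball (0 : Rd d) ‖y‖, 2 ^ (p - 1) * (H z + H (y - z)) := by
          refine setLIntegral_mono (by fun_prop) fun z hz => ?_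
          rw [mem_ball_zero_iff] at hz
          have hz1 : H z = W z := Set.indicator_of_mem (by
            rw [mem_ball_zero_iff]; linarith) _
          have hz2 : H (y - z) = W (y - z) := Set.indicator_of_mem (by
            rw [mem_ball_zero_iff]; linarith [norm_sub_le y z]) _
          rw [hz1, hz2]
          exact lintegral_sub_rpow_triangle hp.le hf y z
      _ ≤ ∫⁻ z, 2 ^ (p - 1) * (H z + H (y - z)) := setLIntegral_le_lintegral _ _
      _ = 2 ^ (p - 1) * (2 * ∫⁻ z, H z) := by
          rw [lintegral_const_mul _ (by fun_prop), lintegral_add_left hHm,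
            lintegral_sub_left_eq_self H y, two_mul]
      _ = 2 ^ p * ∫⁻ z, H z := by
          rw [← mul_assoc]
          congr 1
          nth_rw 2 [← ENNReal.rpow_one 2]
          rw [← ENNReal.rpow_add _ _ (by norm_num) (by norm_num), sub_add_cancel]
      _ ≤ _ := by gcongr
  have : Nontrivial (Rd d) := ⟨y, 0, hy⟩
  have h2 : volume (Metric.ball (0 : Rd d) ‖y‖) = ‖y‖ₑ ^ (d : ℝ) * c := by
    rw [Measure.addHaar_ball _ _ hr.le, finrank_euclideanSpace_fin, ENNReal.ofReal_pow hr.le,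
      ofReal_norm, ENNReal.rpow_natCast]
  have hyd0 : ‖y‖ₑ ^ (d : ℝ) ≠ 0 := by simp [hy]
  have hydt : ‖y‖ₑ ^ (d : ℝ) ≠ ⊤ := ENNReal.rpow_ne_top_of_nonneg (by positivity) (by simp)
  rw [h2, ← ENNReal.le_div_iff_mul_le (Or.inl (mul_ne_zero hyd0 hc0))
    (Or.inl (ENNReal.mul_ne_top hydt hct))] at h1
  -- The factor `‖y‖^d` in the ball's volume cancels that in `‖y‖^(d + s p)`, leaving `‖y‖^(s p)`.
  refine h1.trans (le_of_eq ?_)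
  rw [ENNReal.mul_rpow_of_nonneg _ _ he0.le, he, ENNReal.rpow_add (x := ‖y‖ₑ) _ _ (by simp [hy]) (by simp),
    ENNReal.div_eq_inv_mul, ENNReal.div_eq_inv_mul, ENNReal.mul_inv (Or.inl hyd0) (Or.inl hydt)]
  calc _ = ((‖y‖ₑ ^ (d : ℝ))⁻¹ * ‖y‖ₑ ^ (d : ℝ)) * (c⁻¹ * (2 ^ p * 2 ^ ((d : ℝ) + s * p)) *
        gagliardo s p f * ‖y‖ₑ ^ (s * p)) := by ring
    _ = _ := by rw [ENNReal.inv_mul_cancel hyd0 hydt, one_mul]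

end Fractional

/-! ### Modulus of continuity from the weak gradient -/

section WeakDerivative

variable {d : ℕ} {p : ℝ} {f V : Rd d → ℝ}

/-- The uniform distribution on the segment from `0` to `y`. -/
noncomputable def segmentMeasure {d : ℕ} (y : Rd d) : Measure (Rd d) :=
  (volume.restrict (Set.Ioc (0 : ℝ) 1)).map fun t => t • y

instance (y : Rd d) : IsProbabilityMeasure (segmentMeasure y) := by
  have : IsProbabilityMeasure (volume.restrict (Set.Ioc (0 : ℝ) 1)) := ⟨by simp⟩
  exact Measure.isProbabilityMeasure_map (by fun_prop)

theorem integral_fderiv_segmentMeasure {u : Rd d → ℝ} (hu : ContDiff ℝ ∞ u) (x y : Rd d) :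
    ∫ z, fderiv ℝ u (x + z) y ∂(segmentMeasure y) = u (x + y) - u x := by
  have hc : Continuous fun z => fderiv ℝ u (x + z) y :=
    ((hu.continuous_fderiv (by simp)).comp (by fun_prop)).clm_apply continuous_const
  rw [segmentMeasure, integral_map (by fun_prop) hc.aestronglyMeasurable,
    ← intervalIntegral.integral_of_le zero_le_one]
  have h : ∀ t ∈ Set.uIcc (0 : ℝ) 1,
      HasDerivAt (fun t : ℝ => u (x + t • y)) (fderiv ℝ u (x + t • y) y) t := fun t _ => by
    have h1 : HasDerivAt (fun t : ℝ => x + t • y) y t := by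
      simpa using ((hasDerivAt_id t).smul_const y).const_add x
    exact ((hu.differentiable (by simp)).differentiableAt.hasFDerivAt).comp_hasDerivAt t h1
  rw [intervalIntegral.integral_eq_sub_of_hasDerivAt h
    ((hc.comp (by fun_prop : Continuous fun t : ℝ => t • y)).intervalIntegrable _ _)]
  simp

/-- If `V` is the weak directional derivative of `f` along `y`, then `f(x - y) - f(x)` is minus the
mean of `V` along the segment from `x` to `x - y`. -/
theorem sub_ae_eq_integral_segmentMeasure (hp : 1 < p) (hf : Integrable f) (hV : Measurable V)
    (hVp : MemLp V (ENNReal.ofReal p) volume) (y : Rd d)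
    (h : ∀ u : Rd d → ℝ, ContDiff ℝ ∞ u → HasCompactSupport u →
      ∫ x, f x * fderiv ℝ u x y = -∫ x, V x * u x) :
    ∀ᵐ x, f (x - y) - f x = -∫ z, V (x - z) ∂(segmentMeasure y) := by
  set μ := segmentMeasure y with hμ
  have hp1 : (1 : ℝ≥0∞) ≤ ENNReal.ofReal p := by simpa using hp.le
  have hWp : MemLp (fun x => ∫ z, V (x - z) ∂μ) (ENNReal.ofReal p) volume :=
    ⟨(measurable_smooth hV).aestronglyMeasurable, (eLpNorm_smooth_le hp hV).trans_lt hVp.2⟩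
  have hfy : Integrable fun x => f (x - y) := hf.comp_sub_right y
  -- Both sides are tested against smooth `u`. The difference moves onto `u`, becomes a segment mean
  -- of derivatives of `u`, and the weak derivative is used on each shifted test function `u(· +
  -- z)`.
  refine ae_eq_of_integral_contDiff_smul_eq (hfy.sub hf).locallyIntegrable
    (hWp.locallyIntegrable hp1).neg fun u hu hus => ?_
  have hub : ∃ C, ∀ x, ‖u x‖ ≤ C := hu.continuous.bounded_above_of_compact_support hus
  obtain ⟨C, hC⟩ := hub
  have hui : Integrable u := hu.continuous.integrable_of_hasCompactSupport hus
  have hdc : Continuous fun x => fderiv ℝ u x y :=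
    (hu.continuous_fderiv (by simp)).clm_apply continuous_const
  obtain ⟨C', hC'⟩ := hdc.bounded_above_of_compact_support (hus.fderiv_apply ℝ y)
  have hprod1 : Integrable (fun z : Rd d × Rd d => f z.1 * fderiv ℝ u (z.1 + z.2) y)
      (volume.prod μ) := by
    refine (hf.comp_fst μ).mul_bdd (c := C') ?_ (Filter.Eventually.of_forall fun z => hC' _)
    exact (hdc.comp (by fun_prop : Continuous fun z : Rd d × Rd d => z.1 + z.2)).aestronglyMeasurable
  have hprod2 : Integrable (fun z : Rd d × Rd d => V (z.1 - z.2) * u z.1) (volume.prod μ) := by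
    have i1 := (integrable_prod_translate (μ := μ) (hV.abs.pow_const p)
      (hVp.integrable_abs_rpow hp)).const_mul C
    have i2 := (hui.comp_fst μ).norm
    refine Integrable.mono' (i1.add i2) ((hV.comp (measurable_fst.sub measurable_snd)).mul
      (hu.continuous.measurable.comp measurable_fst)).aestronglyMeasurable
      (Filter.Eventually.of_forall fun z => ?_)
    have key : |V (z.1 - z.2)| ≤ |V (z.1 - z.2)| ^ p + 1 := by
      rcases le_total |V (z.1 - z.2)| 1 with h1 | h1
      · have : 0 ≤ |V (z.1 - z.2)| ^ p := by positivity
        linarith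
      · have := Real.rpow_le_rpow_of_exponent_le h1 hp.le
        rw [Real.rpow_one] at this
        linarith
    have hn := norm_nonneg (u z.1)
    have hpw : 0 ≤ |V (z.1 - z.2)| ^ p := by positivity
    simp only [Pi.add_apply, norm_mul, Real.norm_eq_abs (V _)]
    nlinarith [mul_le_mul_of_nonneg_right key hn, mul_le_mul_of_nonneg_left (hC z.1) hpw]
  calc ∫ x, u x • (f (x - y) - f x)
      = (∫ x, f (x - y) * u x) - ∫ x, f x * u x := by
        rw [← integral_sub (hfy.mul_bdd (c := C) hu.continuous.aestronglyMeasurable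
          (Filter.Eventually.of_forall hC)) (hf.mul_bdd (c := C) hu.continuous.aestronglyMeasurable
          (Filter.Eventually.of_forall hC))]
        congr 1 with x
        rw [smul_eq_mul]; ring
    _ = ∫ x, f x * (u (x + y) - u x) := by
        have e : ∫ x, f (x - y) * u x = ∫ x, f x * u (x + y) := by
          rw [← integral_add_right_eq_self _ y]
          simp
        have huy : Continuous fun x => u (x + y) := hu.continuous.comp (by fun_prop)
        rw [e, ← integral_sub (hf.mul_bdd (c := C) huy.aestronglyMeasurable
          (Filter.Eventually.of_forall fun x => hC _))
          (hf.mul_bdd (c := C) hu.continuous.aestronglyMeasurable (Filter.Eventually.of_forall hC))]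
        simp_rw [mul_sub]
    _ = ∫ x, ∫ z, f x * fderiv ℝ u (x + z) y ∂μ := by
        congr 1 with x
        rw [integral_const_mul, integral_fderiv_segmentMeasure hu]
    _ = ∫ z, (∫ x, f x * fderiv ℝ u (x + z) y) ∂μ := integral_integral_swap hprod1
    _ = ∫ z, (-∫ x, V x * u (x + z)) ∂μ := by
        congr 1 with z
        have := h (fun x => u (x + z)) (hu.comp (by fun_prop))
          (hus.comp_homeomorph (Homeomorph.addRight z))
        simp_rw [fderiv_comp_add_right] at this
        exact this
    _ = -∫ z, (∫ x, V (x - z) * u x) ∂μ := by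
        rw [integral_neg]
        congr 2 with z
        rw [← integral_add_right_eq_self (fun x => V (x - z) * u x) z]
        simp
    _ = -∫ x, ∫ z, V (x - z) * u x ∂μ := by
        rw [integral_integral_swap (f := fun x z => V (x - z) * u x) hprod2]
    _ = ∫ x, u x • -∫ z, V (x - z) ∂μ := by
        rw [← integral_neg]
        congr 1 with x
        rw [integral_mul_const, smul_eq_mul]; ring

/-- A segment mean is an average of translates, hence a contraction of `ℒ_p`. -/
theorem lintegral_sub_rpow_le_of_weak_deriv (hp : 1 < p) (hf : Integrable f)
    (hVp : MemLp V (ENNReal.ofReal p) volume) (y : Rd d)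
    (h : ∀ u : Rd d → ℝ, ContDiff ℝ ∞ u → HasCompactSupport u →
      ∫ x, f x * fderiv ℝ u x y = -∫ x, V x * u x) :
    ∫⁻ x, ‖f (x - y) - f x‖ₑ ^ p ≤ ∫⁻ x, ‖V x‖ₑ ^ p := by
  have hVm : Measurable (hVp.1.mk V) := hVp.1.stronglyMeasurable_mk.measurable
  have hVe := hVp.1.ae_eq_mk
  have key := sub_ae_eq_integral_segmentMeasure hp hf hVm ((memLp_congr_ae hVe).1 hVp) y
    fun u hu hus => by
      rw [h u hu hus]
      congr 1
      refine integral_congr_ae ?_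
      filter_upwards [hVe] with x hx
      rw [hx]
  calc ∫⁻ x, ‖f (x - y) - f x‖ₑ ^ p
      = ∫⁻ x, ‖∫ z, hVp.1.mk V (x - z) ∂(segmentMeasure y)‖ₑ ^ p := by
        refine lintegral_congr_ae ?_
        filter_upwards [key] with x hx
        rw [hx, enorm_neg]
    _ ≤ ∫⁻ x, ‖hVp.1.mk V x‖ₑ ^ p := by
        rw [← eLpNorm_ofReal_rpow hp, ← eLpNorm_ofReal_rpow hp]
        exact ENNReal.rpow_le_rpow (eLpNorm_smooth_le hp hVm) (by linarith)
    _ = _ := by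
        refine lintegral_congr_ae ?_
        filter_upwards [hVe] with x hx
        rw [← hx]

theorem MemW1.isWeakPartial (h : MemW1 p f) (k : Fin d) :
    IsWeakPartial p k f (weakPartial p k f) := by
  unfold weakPartial
  rw [dif_pos (h.2 k)]
  exact (h.2 k).choose_spec

theorem MemW1.memLp_weakGrad (h : MemW1 p f) :
    MemLp (weakGrad p f) (ENNReal.ofReal p) volume :=
  memLp_piLp_iff.2 fun k => (h.isWeakPartial k).memLp

theorem MemW1.gradEnergy_lt_top (hp : 1 < p) (h : MemW1 p f) : gradEnergy p f < ⊤ := by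
  have := lintegral_rpow_enorm_lt_top_of_eLpNorm_lt_top (by simp; linarith) ENNReal.ofReal_ne_top
    h.memLp_weakGrad.2
  rwa [ENNReal.toReal_ofReal (by linarith)] at this

theorem MemW1.integral_mul_fderiv (hp : 1 < p) (h : MemW1 p f) (hf : Integrable f) (y : Rd d)
    {u : Rd d → ℝ} (hu : ContDiff ℝ ∞ u) (hus : HasCompactSupport u) :
    ∫ x, f x * fderiv ℝ u x y = -∫ x, (∑ k, y k * weakPartial p k f x) * u x := by
  have hy : y = ∑ k, y k • EuclideanSpace.single k (1 : ℝ) := by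
    ext i
    simp [Pi.single_apply]
  have h1 : ∀ x, f x * fderiv ℝ u x y =
      ∑ k, y k * (f x * fderiv ℝ u x (EuclideanSpace.single k 1)) := fun x => by
    conv_lhs => rw [hy]
    rw [map_sum, Finset.mul_sum]
    refine Finset.sum_congr rfl fun k _ => ?_
    rw [map_smul, smul_eq_mul]; ring
  have h2 : ∀ x, (∑ k, y k * weakPartial p k f x) * u x =
      ∑ k, y k * (weakPartial p k f x * u x) := fun x => by
    rw [Finset.sum_mul]
    exact Finset.sum_congr rfl fun k _ => by ring
  simp_rw [h1, h2]
  rw [integral_finsetSum, integral_finsetSum, ← Finset.sum_neg_distrib]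
  · refine Finset.sum_congr rfl fun k _ => ?_
    rw [integral_const_mul, integral_const_mul, (h.isWeakPartial k).integral_eq u hu hus]
    ring
  · intro k _
    refine Integrable.const_mul ?_ _
    have hp1 : (1 : ℝ≥0∞) ≤ ENNReal.ofReal p := by simpa using hp.le
    simp_rw [mul_comm (weakPartial p k f _), ← smul_eq_mul]
    exact ((h.isWeakPartial k).memLp.locallyIntegrable hp1).integrable_smul_left_of_hasCompactSupport
      hu.continuous hus
  · intro k _
    refine Integrable.const_mul ?_ _
    have hdc : Continuous fun x => fderiv ℝ u x (EuclideanSpace.single k 1) :=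
      (hu.continuous_fderiv (by simp)).clm_apply continuous_const
    obtain ⟨C, hC⟩ := hdc.bounded_above_of_compact_support (hus.fderiv_apply ℝ _)
    exact hf.mul_bdd (c := C) hdc.aestronglyMeasurable (Filter.Eventually.of_forall hC)

/-- The directional weak derivative is `⟨∇f, y⟩`, and Cauchy–Schwarz separates the factor `‖y‖`. -/
theorem MemW1.lintegral_sub_rpow_le (hp : 1 < p) (h : MemW1 p f) (hf : Integrable f) (y : Rd d) :
    ∫⁻ x, ‖f (x - y) - f x‖ₑ ^ p ≤ gradEnergy p f * ‖y‖ₑ ^ p := by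
  have hVp : MemLp (fun x => ∑ k, y k * weakPartial p k f x) (ENNReal.ofReal p) volume :=
    memLp_finsetSum _ fun k _ => (h.isWeakPartial k).memLp.const_mul _
  refine (lintegral_sub_rpow_le_of_weak_deriv hp hf hVp y fun u hu hus =>
    h.integral_mul_fderiv hp hf y hu hus).trans ?_
  rw [gradEnergy, ← lintegral_mul_const' _ _ (ENNReal.rpow_ne_top_of_nonneg (by linarith) (by simp))]
  refine lintegral_mono fun x => ?_
  rw [← ENNReal.mul_rpow_of_nonneg _ _ (by linarith)]
  refine ENNReal.rpow_le_rpow ?_ (by linarith)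
  have e : ∑ k, y k * weakPartial p k f x = inner ℝ (weakGrad p f x) y := by
    simp [PiLp.inner_apply, weakGrad]
  rw [e, ← ofReal_norm, ← ofReal_norm, ← ofReal_norm, ← ENNReal.ofReal_mul (norm_nonneg _)]
  exact ENNReal.ofReal_le_ofReal (norm_inner_le_norm _ _)

end WeakDerivative

/-! ### Combining the two errors, dilation and balancing -/

section Rate

variable {d : ℕ} {p s : ℝ}

theorem exists_average_translate_approx (hp : 1 < p) (hs : 0 < s) :
    ∃ A : ℝ, 0 < A ∧ ∀ (ψ f : Rd d → ℝ) (B : ℝ≥0∞), Measurable ψ → Integrable ψ →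
      ∫ x, ψ x = 1 → MemLp ψ (ENNReal.ofReal p) volume → Measurable f → IsPDF f →
      (∀ y, ∫⁻ x, ‖f (x - y) - f x‖ₑ ^ p ≤ B * ‖y‖ₑ ^ (s * p)) → ∀ n : ℕ, 1 ≤ n →
      ∃ y : Fin n → Rd d,
        eLpNorm (fun x => (∑ i, (n : ℝ)⁻¹ * ψ (x - y i)) - f x) (ENNReal.ofReal p) volume ≤
          ENNReal.ofReal (A * (n : ℝ) ^ (max 1 (p / 2) / p - 1)) *
            eLpNorm ψ (ENNReal.ofReal p) volume +
          B ^ p⁻¹ * ∫⁻ y, ‖ψ y‖ₑ * ‖y‖ₑ ^ s := by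
  obtain ⟨A, hA, happ⟩ := exists_sum_translate_approx (E := Rd d) (vol := volume) hp
  -- The factor 2 is from centring the translates; `A` enters through a `p`-th root.
  refine ⟨A ^ p⁻¹ * 2, by positivity, fun ψ f B hψ hψi hψ1 hψp hf hpdf hB n hn => ?_⟩
  have hp0 : 0 < p := by linarith
  have hn0 : (0 : ℝ) < n := by exact_mod_cast hn
  set μ : Measure (Rd d) := volume.withDensity fun y => ENNReal.ofReal (f y) with hμ
  have hprob : IsProbabilityMeasure μ := ⟨by
    rw [hμ, withDensity_apply _ MeasurableSet.univ, Measure.restrict_univ,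
      ← ofReal_integral_eq_lintegral_ofReal hpdf.integrable
        (Filter.Eventually.of_forall hpdf.nonneg), hpdf.integral_eq_one, ENNReal.ofReal_one]⟩
  obtain ⟨y, hy⟩ := happ μ ψ hψ hψp n
  refine ⟨y, ?_⟩
  set g : Rd d → ℝ := fun x => ∫ t, ψ (x - t) ∂μ with hg
  have hgm : Measurable g := measurable_smooth hψ
  set S : Rd d → ℝ := fun x => ∑ i, (ψ (x - y i) - g x) with hS
  have hSm : Measurable S := Finset.measurable_sum _ fun i _ =>
    (hψ.comp (measurable_id.sub_const _)).sub hgm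
  have hSp : MemLp S (ENNReal.ofReal p) volume := memLp_finsetSum _ fun i _ =>
    (hψp.translate (y i)).sub
      ⟨hgm.aestronglyMeasurable, (eLpNorm_smooth_le hp hψ).trans_lt hψp.2⟩
  have hdecomp : (fun x => (∑ i, (n : ℝ)⁻¹ * ψ (x - y i)) - f x) =
      ((n : ℝ)⁻¹ • S) + fun x => g x - f x := by
    ext x
    simp only [Pi.add_apply, Pi.smul_apply, smul_eq_mul, hS, Finset.sum_sub_distrib,
      Finset.sum_const, Finset.card_univ, Fintype.card_fin, nsmul_eq_mul]
    rw [mul_sub, Finset.mul_sum, inv_mul_cancel_left₀ hn0.ne']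
    ring
  rw [hdecomp]
  refine (eLpNorm_add_le (hSm.const_smul _).aestronglyMeasurable
    (hgm.sub hf).aestronglyMeasurable (by simpa using hp.le)).trans (add_le_add ?_ ?_)
  · set Ψ := eLpNorm ψ (ENNReal.ofReal p) volume with hΨ
    have h1 : (eLpNorm S (ENNReal.ofReal p) volume).toReal ^ p ≤
        A * (n : ℝ) ^ max 1 (p / 2) * (2 * Ψ.toReal) ^ p :=
      (hSp.integral_abs_rpow hp).symm.trans_le hy
    have h2 : (eLpNorm S (ENNReal.ofReal p) volume).toReal ≤
        A ^ p⁻¹ * (n : ℝ) ^ (max 1 (p / 2) / p) * (2 * Ψ.toReal) := by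
      rw [← Real.rpow_le_rpow_iff ENNReal.toReal_nonneg (by positivity) hp0]
      refine h1.trans (le_of_eq ?_)
      rw [Real.mul_rpow (x := A ^ p⁻¹ * (n : ℝ) ^ (max 1 (p / 2) / p)) (by positivity)
        (by positivity), Real.mul_rpow (x := A ^ p⁻¹) (by positivity) (by positivity), Real.rpow_inv_rpow hA.le hp0.ne', ← Real.rpow_mul hn0.le,
        div_mul_cancel₀ _ hp0.ne']
    have hΨt : Ψ ≠ ⊤ := hψp.2.ne
    rw [eLpNorm_const_smul, ← ENNReal.ofReal_toReal hSp.2.ne, ← ENNReal.ofReal_toReal hΨt,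
      ← ENNReal.ofReal_mul (by positivity), ← ofReal_norm, ← ENNReal.ofReal_mul (norm_nonneg _)]
    refine ENNReal.ofReal_le_ofReal ?_
    rw [Real.norm_of_nonneg (by positivity), Real.rpow_sub_one hn0.ne']
    calc (n : ℝ)⁻¹ * (eLpNorm S (ENNReal.ofReal p) volume).toReal
        ≤ (n : ℝ)⁻¹ * (A ^ p⁻¹ * (n : ℝ) ^ (max 1 (p / 2) / p) * (2 * Ψ.toReal)) := by gcongr
      _ = _ := by rw [div_eq_mul_inv _ (n : ℝ)]; ring
  · rw [← ENNReal.rpow_le_rpow_iff hp0, eLpNorm_ofReal_rpow hp,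
      ENNReal.mul_rpow_of_nonneg _ _ hp0.le, ENNReal.rpow_inv_rpow hp0.ne']
    exact lintegral_smooth_sub_rpow_le hp hs hψ hψi hψ1 hf hpdf.nonneg hpdf.integrable hB

section Dilation

variable {φ : Rd d → ℝ} {ν : ℝ}

theorem lintegral_comp_smul_Rd (hν : 0 < ν) {F : Rd d → ℝ≥0∞} (hF : Measurable F) :
    ∫⁻ x, F (ν • x) = ENNReal.ofReal ((ν ^ d)⁻¹) * ∫⁻ x, F x := by
  rw [← lintegral_map hF (measurable_const_smul ν), Measure.map_addHaar_smul _ hν.ne',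
    lintegral_smul_measure, finrank_euclideanSpace_fin, abs_of_pos (by positivity), smul_eq_mul]

theorem measurable_dilate (hφ : Measurable φ) : Measurable (dilate φ ν) :=
  (hφ.comp (measurable_const_smul ν)).const_mul _

theorem integrable_dilate (hν : 0 < ν) (hφ : Integrable φ) : Integrable (dilate φ ν) :=
  ((integrable_comp_smul_iff volume φ hν.ne').2 hφ).const_mul _

theorem integral_dilate (hν : 0 < ν) : ∫ x, dilate φ ν x = ∫ x, φ x := by
  unfold dilate
  rw [integral_const_mul, Measure.integral_comp_smul, finrank_euclideanSpace_fin,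
    abs_of_pos (by positivity), smul_eq_mul, mul_inv_cancel_left₀ (by positivity)]

theorem eLpNorm_dilate (hp : 1 < p) (hν : 0 < ν) (hφ : Measurable φ) :
    eLpNorm (dilate φ ν) (ENNReal.ofReal p) volume =
      ENNReal.ofReal (ν ^ (d * (1 - p⁻¹))) * eLpNorm φ (ENNReal.ofReal p) volume := by
  have hp0 : 0 < p := by linarith
  have hνd : (0 : ℝ) < ν ^ d := by positivity
  have inj : Function.Injective fun x : ℝ≥0∞ => x ^ p := (ENNReal.strictMono_rpow_of_pos hp0).injective
  refine inj ?_
  simp only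
  rw [ENNReal.mul_rpow_of_nonneg _ _ hp0.le, eLpNorm_ofReal_rpow hp, eLpNorm_ofReal_rpow hp]
  unfold dilate
  simp_rw [enorm_mul, ENNReal.mul_rpow_of_nonneg _ _ hp0.le]
  rw [lintegral_const_mul _ (by fun_prop),
    lintegral_comp_smul_Rd hν (F := fun x => ‖φ x‖ₑ ^ p) (by fun_prop), ← mul_assoc]
  congr 1
  rw [← ofReal_norm, Real.norm_of_nonneg hνd.le, ENNReal.ofReal_rpow_of_pos hνd,
    ← ENNReal.ofReal_mul (by positivity), ENNReal.ofReal_rpow_of_pos (by positivity)]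
  congr 1
  rw [← Real.rpow_natCast, ← Real.rpow_mul hν.le, ← Real.rpow_neg hν.le, ← Real.rpow_mul hν.le,
    ← Real.rpow_add hν]
  congr 1
  field_simp
  ring

theorem lintegral_dilate_mul_rpow (hs : 0 < s) (hν : 0 < ν) (hφ : Measurable φ) :
    ∫⁻ x, ‖dilate φ ν x‖ₑ * ‖x‖ₑ ^ s = ENNReal.ofReal (ν ^ (-s)) * ∫⁻ x, ‖φ x‖ₑ * ‖x‖ₑ ^ s := by
  have hνd : (0 : ℝ) < ν ^ d := by positivity
  have h : ∀ x : Rd d, ‖dilate φ ν x‖ₑ * ‖x‖ₑ ^ s =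
      ENNReal.ofReal (ν ^ d * ν ^ (-s)) * (‖φ (ν • x)‖ₑ * ‖ν • x‖ₑ ^ s) := fun x => by
    have e : ENNReal.ofReal (ν ^ (-s)) * ENNReal.ofReal (ν ^ s) = 1 := by
      rw [← ENNReal.ofReal_mul (by positivity), ← Real.rpow_add hν]; simp
    unfold dilate
    rw [enorm_mul, enorm_smul, ENNReal.mul_rpow_of_nonneg _ _ hs.le, ← ofReal_norm,
      ← ofReal_norm ν, Real.norm_of_nonneg hνd.le, Real.norm_of_nonneg hν.le,
      ENNReal.ofReal_rpow_of_pos hν, ENNReal.ofReal_mul hνd.le]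
    calc _ = ENNReal.ofReal (ν ^ d) * 1 * ‖φ (ν • x)‖ₑ * ‖x‖ₑ ^ s := by ring
      _ = _ := by rw [← e]; ring
  simp_rw [h]
  rw [lintegral_const_mul _ (by fun_prop),
    lintegral_comp_smul_Rd hν (F := fun x => ‖φ x‖ₑ * ‖x‖ₑ ^ s) (by fun_prop), ← mul_assoc,
    ← ENNReal.ofReal_mul (by positivity)]
  congr 2
  field_simp

theorem dilate_comp_sub_congr {φ' : Rd d → ℝ} (hν : 0 < ν) (h : φ =ᵐ[volume] φ') (y : Rd d) :
    (fun x => dilate φ ν (x - y)) =ᵐ[volume] fun x => dilate φ' ν (x - y) := by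
  have h1 : (fun x => dilate φ ν x) =ᵐ[volume] fun x => dilate φ' ν x := by
    have q : Measure.QuasiMeasurePreserving (fun x : Rd d => ν • x) volume volume :=
      ⟨measurable_const_smul ν, by
        rw [Measure.map_addHaar_smul _ hν.ne']
        exact Measure.smul_absolutelyContinuous⟩
    filter_upwards [q.ae h] with x hx
    simp only [dilate, hx]
  exact (measurePreserving_sub_right volume y).quasiMeasurePreserving.ae h1

end Dilation

/-- Rate of approximation by mixtures for densities with Hölder `ℒ_p` modulus of continuity. -/
theorem exists_mixture_approx (hp : 1 < p) (hs : 0 < s) {φ : Rd d → ℝ} (hφ : IsPDF φ)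
    (hφp : MemLp φ (ENNReal.ofReal p) volume)
    (hmom : ∫⁻ x, ‖φ x‖ₑ * ‖x‖ₑ ^ s ≠ ⊤) :
    ∃ a b : ℝ, ∀ (f : Rd d → ℝ) (B : ℝ≥0∞), Measurable f → IsPDF f → B ≠ ⊤ →
      (∀ y, ∫⁻ x, ‖f (x - y) - f x‖ₑ ^ p ≤ B * ‖y‖ₑ ^ (s * p)) → ∀ n : ℕ, 1 ≤ n →
      ∃ F ∈ coMix n (locScale φ), eLpNorm (F - f) (ENNReal.ofReal p) volume ≤
        ENNReal.ofReal ((a + B.toReal ^ p⁻¹ * b) *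
          (n : ℝ) ^ (-((1 - max 1 (p / 2) / p) * s / (s + d * (1 - p⁻¹))))) := by
  obtain ⟨A, hA, happ⟩ := exists_average_translate_approx (d := d) hp hs
  set M := ∫⁻ x, ‖φ x‖ₑ * ‖x‖ₑ ^ s with hM
  set N := eLpNorm φ (ENNReal.ofReal p) volume with hN
  refine ⟨A * N.toReal, M.toReal, fun f B hf hpdf hBt hB n hn => ?_⟩
  have hp0 : 0 < p := by linarith
  have hn0 : (0 : ℝ) < n := by exact_mod_cast hn
  have hpi : p⁻¹ < 1 := inv_lt_one_of_one_lt₀ hp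
  set δ : ℝ := d * (1 - p⁻¹) with hδ
  have hδ0 : 0 ≤ δ := mul_nonneg (Nat.cast_nonneg d) (by linarith)
  set τ : ℝ := 1 - max 1 (p / 2) / p with hτ
  -- The solution of `n^(-τ) ν^δ = ν^(-s)`, which equates sampling error and bias up to constants.
  set ν : ℝ := (n : ℝ) ^ (τ / (s + δ)) with hν
  have hν0 : 0 < ν := by positivity
  -- Estimates use a measurable version of `φ`; the mixture itself must be built from `φ`.
  set φ' := hφ.integrable.1.mk φ with hφ'
  have hφm : Measurable φ' := hφ.integrable.1.stronglyMeasurable_mk.measurable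
  have hφe : φ =ᵐ[volume] φ' := hφ.integrable.1.ae_eq_mk
  have hφ'N : eLpNorm φ' (ENNReal.ofReal p) volume = N := (eLpNorm_congr_ae hφe).symm
  have hφ'M : ∫⁻ x, ‖φ' x‖ₑ * ‖x‖ₑ ^ s = M := by
    refine lintegral_congr_ae ?_
    filter_upwards [hφe] with x hx
    rw [hx]
  have hψm := measurable_dilate (ν := ν) hφm
  have hψN := eLpNorm_dilate hp hν0 hφm
  have hψM := lintegral_dilate_mul_rpow hs hν0 hφm
  rw [hφ'N] at hψN
  rw [hφ'M] at hψM
  obtain ⟨y, hy⟩ := happ (dilate φ' ν) f B hψm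
    (integrable_dilate hν0 (hφ.integrable.congr hφe))
    ((integral_dilate hν0).trans ((integral_congr_ae hφe).symm.trans hφ.integral_eq_one))
    ⟨hψm.aestronglyMeasurable, by
      rw [hψN]; exact ENNReal.mul_lt_top ENNReal.ofReal_lt_top hφp.2⟩ hf hpdf hB n hn
  refine ⟨fun x => ∑ i, (n : ℝ)⁻¹ * dilate φ ν (x - y i),
    ⟨fun _ => (n : ℝ)⁻¹, fun i x => dilate φ ν (x - y i), fun i => ⟨y i, ν, hν0, rfl⟩,
      fun _ => by positivity, by simp [hn0.ne'], rfl⟩, ?_⟩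
  have hae : ((fun x => ∑ i, (n : ℝ)⁻¹ * dilate φ ν (x - y i)) - f) =ᵐ[volume]
      fun x => (∑ i, (n : ℝ)⁻¹ * dilate φ' ν (x - y i)) - f x := by
    have := ae_all_iff.2 fun i => dilate_comp_sub_congr hν0 hφe (y i)
    filter_upwards [this] with x hx
    simp only [Pi.sub_apply, hx]
  rw [eLpNorm_congr_ae hae]
  refine hy.trans (le_of_eq ?_)
  have hsδ : s + δ ≠ 0 := by positivity
  have e1 : (n : ℝ) ^ (max 1 (p / 2) / p - 1) * ν ^ δ = (n : ℝ) ^ (-(τ * s / (s + δ))) := by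
    rw [hν, ← Real.rpow_mul hn0.le, ← Real.rpow_add hn0]
    congr 1
    rw [show max 1 (p / 2) / p - 1 = -τ by rw [hτ]; ring]
    field_simp
    ring
  have e2 : ν ^ (-s) = (n : ℝ) ^ (-(τ * s / (s + δ))) := by
    rw [hν, ← Real.rpow_mul hn0.le]
    congr 1
    ring
  have hNt : N ≠ ⊤ := hφp.2.ne
  rw [hψN, hψM, e2]
  nth_rw 1 [← ENNReal.ofReal_toReal hNt, ← ENNReal.ofReal_toReal hmom]
  rw [← ENNReal.ofReal_toReal (ENNReal.rpow_ne_top_of_nonneg (inv_nonneg.2 hp0.le) hBt),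
    ← ENNReal.toReal_rpow, ← ENNReal.ofReal_mul (by positivity),
    ← ENNReal.ofReal_mul (by positivity), ← ENNReal.ofReal_mul (by positivity),
    ← ENNReal.ofReal_mul (by positivity), ← ENNReal.ofReal_add (by positivity) (by positivity),
    ← e1]
  congr 1
  ring

theorem lintegral_sub_rpow_congr {f g : Rd d → ℝ} (h : f =ᵐ[volume] g) (y : Rd d) :
    ∫⁻ x, ‖f (x - y) - f x‖ₑ ^ p = ∫⁻ x, ‖g (x - y) - g x‖ₑ ^ p := by
  refine lintegral_congr_ae ?_
  filter_upwards [h, (measurePreserving_sub_right volume y).quasiMeasurePreserving.ae h]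
    with x h1 h2
  rw [h1, h2]

theorem IsPDF.exists_measurable {f : Rd d → ℝ} (hf : IsPDF f) :
    ∃ g : Rd d → ℝ, Measurable g ∧ IsPDF g ∧ f =ᵐ[volume] g := by
  -- Truncation at 0 restores nonnegativity at every point.
  set g : Rd d → ℝ := fun x => max (hf.integrable.1.mk f x) 0 with hg
  have hfg : f =ᵐ[volume] g := by
    filter_upwards [hf.integrable.1.ae_eq_mk] with x hx
    rw [hg]
    simp only [← hx, max_eq_left (hf.nonneg x)]
  exact ⟨g, hf.integrable.1.stronglyMeasurable_mk.measurable.max measurable_const,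
    ⟨fun x => le_max_right _ _, hf.integrable.congr hfg,
      (integral_congr_ae hfg).symm.trans hf.integral_eq_one⟩, hfg⟩

/-- Sobolev regularity bounds the `ℒ_p` modulus of continuity in terms of the smoothness alone. -/
theorem exists_modulus_const (d : ℕ) (hp : 1 < p) (hs : 0 < s) (hs1 : s ≤ 1) :
    ∃ c : ℝ≥0∞, c ≠ ⊤ ∧ ∀ f : Rd d → ℝ, IsPDF f → MemW s p f → smoothness s p f ≠ ⊤ ∧
      ∀ y, ∫⁻ x, ‖f (x - y) - f x‖ₑ ^ p ≤ c * smoothness s p f * ‖y‖ₑ ^ (s * p) := by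
  rcases hs1.lt_or_eq with h | rfl
  · refine ⟨2 ^ p * 2 ^ ((d : ℝ) + s * p) / volume (Metric.ball (0 : Rd d) 1), ?_,
      fun f hf hW => ?_⟩
    · refine ENNReal.div_ne_top (ENNReal.mul_ne_top ?_ ?_)
        (Metric.measure_ball_pos volume _ one_pos).ne'
      · exact ENNReal.rpow_ne_top_of_nonneg (by linarith) (by simp)
      · exact ENNReal.rpow_ne_top_of_nonneg (by positivity) (by simp)
    · rw [MemW, if_pos h] at hW
      rw [smoothness, if_pos h]
      refine ⟨hW.2.ne, fun y => ?_⟩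
      obtain ⟨g, hg, -, hfg⟩ := hf.exists_measurable
      rw [lintegral_sub_rpow_congr hfg, gagliardo_congr hfg]
      exact lintegral_sub_rpow_le_gagliardo hp hs hg y
  · refine ⟨1, by simp, fun f hf hW => ?_⟩
    rw [MemW, if_neg (lt_irrefl _)] at hW
    rw [smoothness, if_neg (lt_irrefl _)]
    refine ⟨(hW.gradEnergy_lt_top hp).ne, fun y => ?_⟩
    simpa using hW.lintegral_sub_rpow_le hp hf.integrable y

end Rate

end MixtureApprox

/-! ### The rate in terms of the conjugate exponent -/

theorem corollary1 (d : ℕ) (p q s K₁ : ℝ) (hp : 1 < p) (hpq : 1 / p + 1 / q = 1)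
    (hs0 : 0 < s) (hs1 : s ≤ 1)
    (φ : Rd d → ℝ) (hφ : IsPDF φ) (hφp : MemLp φ (ENNReal.ofReal p) volume)
    (hmom_int : Integrable (fun x => ‖x‖ ^ s * φ x) volume)
    (hmom : ∫ x, ‖x‖ ^ s * φ x ≤ K₁) :
    ∃ K : ℝ≥0∞ → ℝ, ∀ f₀ : Rd d → ℝ, IsPDF f₀ → MemW s p f₀ →
      ∃ f : ℕ → Rd d → ℝ, ∀ m : ℕ, 1 ≤ m →
        f m ∈ coMix m (locScale φ) ∧
        (p < 2 →
          eLpNorm (f m - f₀) (ENNReal.ofReal p) volume ≤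
            ENNReal.ofReal (K (smoothness s p f₀) * (m : ℝ) ^ (-(s / (s * q + d))))) ∧
        (2 ≤ p →
          eLpNorm (f m - f₀) (ENNReal.ofReal p) volume ≤
            ENNReal.ofReal (K (smoothness s p f₀) * (m : ℝ) ^ (-(s * q / (2 * (s * q + d)))))) := by
  have hp0 : 0 < p := by linarith
  have hM : ∫⁻ x, ‖φ x‖ₑ * ‖x‖ₑ ^ s ≠ ⊤ := by
    have h := hmom_int.2.ne
    rw [← lintegral_congr fun x => ?_]
    exact h
    rw [enorm_mul, mul_comm, Real.enorm_rpow_of_nonneg (norm_nonneg x) hs0.le, enorm_norm]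
  obtain ⟨c, hc, hmod⟩ := exists_modulus_const d hp hs0 hs1
  obtain ⟨a, b, happ⟩ := exists_mixture_approx hp hs0 hφ hφp hM
  -- `a`, `b` and `c` are fixed before `f₀`, which enters only through its smoothness `t`.
  refine ⟨fun t => a + (c * t).toReal ^ p⁻¹ * b, fun f₀ hf₀ hW => ?_⟩
  obtain ⟨hfin, hB⟩ := hmod f₀ hf₀ hW
  obtain ⟨g, hgm, hg, hfg⟩ := hf₀.exists_measurable
  have key := happ g (c * smoothness s p f₀) hgm hg (ENNReal.mul_ne_top hc hfin) fun y => by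
    rw [← lintegral_sub_rpow_congr hfg]; exact hB y
  choose! F hF hFg using key
  have hqinv : q⁻¹ = 1 - p⁻¹ := by rw [one_div, one_div] at hpq; linarith
  have hpi : p⁻¹ < 1 := inv_lt_one_of_one_lt₀ hp
  have hq0 : 0 < q := inv_pos.1 (by rw [hqinv]; linarith)
  have hsqd : s * q + d ≠ 0 := by positivity
  have hden : s + d * (1 - p⁻¹) = (s * q + d) / q := by rw [← hqinv]; field_simp
  refine ⟨F, fun m hm => ⟨hF m hm, fun hp2 => ?_, fun hp2 => ?_⟩⟩
  all_goals
    have hFm := hFg m hm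
    rw [eLpNorm_congr_ae (show F m - f₀ =ᵐ[volume] F m - g from
      Filter.EventuallyEq.rfl.sub hfg)]
    refine hFm.trans (le_of_eq ?_)
    congr 3
    rw [hden]
  -- Here `τ = 1/q`; in the other case `τ = 1/2`.
  · rw [max_eq_left (by linarith), one_div, ← hqinv]
    field_simp
  · rw [max_eq_right (by linarith)]
    field_simp
    ring
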